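/- Consider a bipartite Bell scenario with settings $X,Y$ and outcomes $A,B$ (discrete variables, with arbitrary sets of values), and a phenomenon for it, that is, a joint probability distribution $\mathcal P(ABXY)$. Suppose that $\mathcal P$ is no-signalling: $\mathcal P(A|XY)=\mathcal P(A|X)$ and $\mathcal P(B|XY)=\mathcal P(B|Y)$ for all values for which these conditional probabilities are defined. A causal model for $\mathcal P$ consists of a finite, possibly empty, set $\Lambda$ of (discrete) latent variables, a directed acyclic graph $\mathcal G$ with nodes $\{A,B,X,Y\}\cup\Lambda$, and a joint distribution $P(ABXY\Lambda)$ that factorises as the product of the conditional probabilities of the variables given their parents in $\mathcal G$, such that $\mathcal P(ABXY)=\sum_\Lambda P(ABXY\Lambda)$. It has no fine-tuning if for all pairwise disjoint sets $C,D,E$ of observable variables, each conditional independence $(C\perp D\,|\,E)$ that holds in $\mathcal P$ corresponds to a d-separation $(C\perp D\,|\,E)_d$ in $\mathcal G$. It is factorisable if $P(AB|XY)=\sum_\Lambda P(\Lambda)P(A|X\Lambda)P(B|Y\Lambda)$ for all values of $A,B,X,Y$ with $P(XY)\neq0$. If some causal model for the no-signalling phenomenon $\mathcal P$ has no fine-tuning,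 then $\mathcal P$ is Bell-local: there is a factorisable causal model for $\mathcal P$. Nothing is assumed about the distribution of the settings (such as independence of $X$ and $Y$), about the dependence of the outcomes on the local settings, or about the independence of the settings from the latent variables (free choice, $\Lambda$-independence). -/

import Mathlib

universe u

noncomputable section

namespace BellCausal

/-! ## Discrete distributions over a family of variables -/

section Prob

variable {N : Type*} {S : N → Type*}

/-- The marginal probability, under the joint distribution `P` of the variables indexed by `N`,
that each variable in `s` takes the value that it has in the assignment `x`. -/
def marg (P : PMF (∀ v, S v)) (s : Set N) (x : ∀ v, S v) : ENNReal :=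
  P.toOuterMeasure {ω | ∀ v ∈ s, ω v = x v}

/-- The conditional probability `P(s | t)` evaluated at the assignment `x`; its value is `0`
when the event conditioned on has probability zero. -/
def condProb (P : PMF (∀ v, S v)) (s t : Set N) (x : ∀ v, S v) : ENNReal :=
  marg P (s ∪ t) x / marg P t x

/-- Conditional independence `(C ⫫ D | E)` of sets of discrete variables:
`P(C, D, E) P(E) = P(C, E) P(D, E)` for all values of the variables. -/
def CondIndep (P : PMF (∀ v, S v)) (C D E : Set N) : Prop :=
  ∀ x, marg P (C ∪ D ∪ E) x * marg P E x = marg P (C ∪ E) x * marg P (D ∪ E) x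

end Prob

/-! ## Directed acyclic graphs and d-separation -/

/-- A directed acyclic graph on the nodes `N`. -/
structure DAG (N : Type*) where
  /-- `edge u v` means that there is an arrow `u → v` -/
  edge : N → N → Prop
  acyclic : ∀ v, ¬ Relation.TransGen edge v v

namespace DAG

variable {N : Type*} (G : DAG N)

/-- The set of parents (direct causes) of a node. -/
def parents (v : N) : Set N := {w | G.edge w v}

/-- `p` lists the successive nodes of a path from `c` to `d`, the edges of which may be traversed
in either direction.  By acyclicity the nodes determine the edges. -/
structure IsPath (p : List N) (c d : N) : Prop where
  head : p.head? = some c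
  last : p.getLast? = some d
  chain : p.IsChain (fun v w => G.edge v w ∨ G.edge w v)
  nodup : p.Nodup

/-- The path `p` is blocked by `Z`: it has a chain or a fork whose middle node is in `Z`, or a
head-to-head node from which there is no directed path (of length zero or more) into `Z`. -/
def Blocked (p : List N) (Z : Set N) : Prop :=
  ∃ a b c, [a, b, c] <:+: p ∧
    ((((G.edge a b ∧ G.edge b c) ∨ (G.edge c b ∧ G.edge b a) ∨ (G.edge b a ∧ G.edge b c))
        ∧ b ∈ Z) ∨
     ((G.edge a b ∧ G.edge c b) ∧ ∀ z ∈ Z, ¬ Relation.ReflTransGen G.edge b z))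

/-- d-separation `(C ⫫ D | Z)_d`: every path from `C` to `D` is blocked by `Z`. -/
def DSep (C D Z : Set N) : Prop :=
  ∀ c ∈ C, ∀ d ∈ D, ∀ p, G.IsPath p c d → G.Blocked p Z

/-- The distribution `P` is compatible with `G`: it factorises as the product of the conditional
probabilities of the variables given their parents. -/
def Compatible [Fintype N] {S : N → Type*} (P : PMF (∀ v, S v)) : Prop :=
  ∀ x, P x = ∏ v, condProb P {v} (G.parents v) x

end DAG

/-! ## Bipartite Bell scenarios, phenomena and causal models -/

/-- Names of the four observable variables: outcomes `A`, `B` and settings `X`, `Y`. -/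
inductive Obs
  | A
  | B
  | X
  | Y
  deriving DecidableEq

instance : Fintype Obs := ⟨{.A, .B, .X, .Y}, fun o => by cases o <;> simp⟩

/-- A bipartite Bell scenario: each party has a set of measurements and a set of outcomes. -/
structure BellScenario where
  settingA : Type u
  settingB : Type u
  outcomeA : Type u
  outcomeB : Type u

/-- The set of values of each observable variable. -/
def BellScenario.Val (S : BellScenario.{u}) : Obs → Type u
  | .A => S.outcomeA
  | .B => S.outcomeB
  | .X => S.settingA
  | .Y => S.settingB

/-- A phenomenon: a joint (discrete) probability distribution of `A`, `B`, `X`, `Y`. -/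
abbrev BellScenario.Phenomenon (S : BellScenario.{u}) : Type u := PMF (∀ o, S.Val o)

variable {S : BellScenario.{u}}

/-- No-signalling: `P(A | X Y) = P(A | X)` and `P(B | X Y) = P(B | Y)` for all values for which
these conditional probabilities are defined. -/
def NoSignalling (P : S.Phenomenon) : Prop :=
  ∀ x, marg P {Obs.X, Obs.Y} x ≠ 0 →
    condProb P {Obs.A} {Obs.X, Obs.Y} x = condProb P {Obs.A} {Obs.X} x ∧
    condProb P {Obs.B} {Obs.X, Obs.Y} x = condProb P {Obs.B} {Obs.Y} x

/-- The set of values of each variable, observable or latent, when the latent variables `i` have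
the sets of values `T i`. -/
abbrev NodeVal (S : BellScenario.{u}) {L : Type} (T : L → Type u) : Obs ⊕ L → Type u
  | Sum.inl o => S.Val o
  | Sum.inr i => T i

/-- The values of the observable variables in an assignment of values to all variables. -/
def obsPart {L : Type} {T : L → Type u} (ω : ∀ v, NodeVal S T v) : ∀ o, S.Val o :=
  fun o => ω (Sum.inl o)

/-- A causal model for the phenomenon `P`: finitely many (possibly no) discrete latent variables,
a DAG on the observable and the latent variables, and a joint distribution of all of them that is
compatible with the DAG and has `P` as its marginal on the observable variables. -/
structure CausalModel (P : S.Phenomenon) where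
  /-- names of the latent variables -/
  Latent : Type
  [fintypeLatent : Fintype Latent]
  /-- the set of values of each latent variable -/
  latentVal : Latent → Type u
  graph : DAG (Obs ⊕ Latent)
  joint : PMF (∀ v, NodeVal S latentVal v)
  compatible : graph.Compatible joint
  marginal : joint.map obsPart = P

attribute [instance] CausalModel.fintypeLatent

namespace CausalModel

variable {P : S.Phenomenon} (Γ : CausalModel P)

/-- No fine-tuning (faithfulness): every conditional independence between observable variables
that holds in the phenomenon is matched by a d-separation in the causal graph. -/
def Faithful : Prop :=
  ∀ C D E : Set Obs, Disjoint C D → Disjoint C E → Disjoint D E → CondIndep P C D E →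
    Γ.graph.DSep (Sum.inl '' C) (Sum.inl '' D) (Sum.inl '' E)

/-- The assignment that consists of the values `x` of the observable variables and the values `l`
of the latent variables. -/
def assign (x : ∀ o, S.Val o) (l : ∀ i, Γ.latentVal i) :
    ∀ v, NodeVal S Γ.latentVal v
  | Sum.inl o => x o
  | Sum.inr i => l i

/-- The set of all latent variables, as nodes of the causal graph. -/
def latents : Set (Obs ⊕ Γ.Latent) := Set.range Sum.inr

/-- Factorisability: `P(A B | X Y) = ∑_Λ P(Λ) P(A | X Λ) P(B | Y Λ)` for all values of
`A, B, X, Y` with `P(X Y) ≠ 0`, where `Λ` is the collection of all latent variables.  (If some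
`P(X Λ)` or `P(Y Λ)` with `P(Λ) ≠ 0` vanishes, the right-hand sides add up to less than `1` over
`A, B`, so the equations also demand that the conditionals that matter are defined.) -/
def Factorisable : Prop :=
  ∀ x : ∀ o, S.Val o, marg P {Obs.X, Obs.Y} x ≠ 0 →
    condProb P {Obs.A, Obs.B} {Obs.X, Obs.Y} x =
      ∑' l : ∀ i, Γ.latentVal i,
        marg Γ.joint Γ.latents (Γ.assign x l) *
        condProb Γ.joint {Sum.inl Obs.A} ({Sum.inl Obs.X} ∪ Γ.latents) (Γ.assign x l) *
        condProb Γ.joint {Sum.inl Obs.B} ({Sum.inl Obs.Y} ∪ Γ.latents) (Γ.assign x l)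

end CausalModel

/-- A phenomenon is Bell-local when it has a factorisable causal model (a factorisable
hidden-variable model). -/
def BellLocal (P : S.Phenomenon) : Prop := ∃ Γ : CausalModel P, Γ.Factorisable

end BellCausal

end

/-! No-signalling means A ⫫ Y | X and B ⫫ X | Y in the phenomenon. Without fine-tuning, both are
d-separations of the causal graph, and this is all that faithfulness has to provide.

The hidden variable of the new model cannot be the full collection of latent variables, since some
of them may be correlated with the settings. It is instead the joint value of a set W of nodes
(`common`): those connected to A avoiding X in the moral graph of the ancestors of A, Y, X, and also
connected to B avoiding Y in the moral graph of the ancestors of B, X, Y. W may contain observable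
nodes, even A or B. The two separations (`LocallySeparated`) imply that W contains the parents of
its elements and no ancestor of X or Y. The factorisation of the joint distribution then gives W ⫫
XY, (A,W) ⫫ Y | X, (B,W) ⫫ X | Y, A ⫫ B | XYW, and hence, where the conditionals are defined,
P(AB|XY) = ∑_w P(w|XY) P(A|XYw) P(B|XYw) = ∑_w P(w) P(A|Xw) P(B|Yw). This is `exists_decomposition`;
`bellLocal_of_decomposition` realises it by a causal model with a single latent variable.

Two general facts link graph and probability. A moral connection yields an unblocked path
(`DSep.not_moralConn`), so d-separation becomes separation in an undirected graph. Such separation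
gives conditional independence (`Compatible.condIndep_of_moral_closed`), because the product over a
parent-closed set splits into two groups of factors. -/

namespace BellCausal

/-! ### d-separation and moral graphs of ancestral subgraphs -/

namespace DAG

variable {N : Type*} (G : DAG N)

/-- The ancestors of the nodes of `Z`, including the nodes of `Z` themselves. -/
def Anc (Z : Set N) : Set N := {v | ∃ z ∈ Z, Relation.ReflTransGen G.edge v z}

theorem subset_anc (Z : Set N) : Z ⊆ G.Anc Z := fun z hz => ⟨z, hz, .refl⟩

theorem anc_of_edge {Z : Set N} {u v : N} (h : G.edge u v) (hv : v ∈ G.Anc Z) : u ∈ G.Anc Z :=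
  let ⟨z, hz, hvz⟩ := hv; ⟨z, hz, .head h hvz⟩

theorem anc_mono {Z Z' : Set N} (h : Z ⊆ Z') : G.Anc Z ⊆ G.Anc Z' :=
  fun _ ⟨z, hz, hvz⟩ => ⟨z, h hz, hvz⟩

theorem edge_asymm {u v : N} (h : G.edge u v) : ¬ G.edge v u :=
  fun h' => G.acyclic u (.head h (.single h'))

/-- Adjacency in the moral graph of the subgraph on `M`. -/
def MoralAdj (M : Set N) (u v : N) : Prop :=
  G.edge u v ∨ G.edge v u ∨ ∃ w ∈ M, G.edge u w ∧ G.edge v w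

/-- `v` is connected to `c` in the moral graph of the subgraph on `M` with `Z` deleted. -/
inductive MoralConn (M Z : Set N) (c : N) : N → Prop
  | refl : MoralConn M Z c c
  | step {v u : N} : MoralConn M Z c v → G.MoralAdj M v u → u ∈ M → u ∉ Z → MoralConn M Z c u

/-- A walk from `d` to `c` that is not blocked by `Z`. -/
structure ActiveWalk (Z : Set N) (p : List N) (d c : N) : Prop where
  head : p.head? = some d
  last : p.getLast? = some c
  chain : p.IsChain (fun v w => G.edge v w ∨ G.edge w v)
  active : ¬ G.Blocked p Z

variable {G} {Z : Set N}

theorem Blocked.mono {p q : List N} (h : p <:+: q) (hp : G.Blocked p Z) : G.Blocked q Z :=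
  let ⟨a, b, c, habc, H⟩ := hp; ⟨a, b, c, habc.trans h, H⟩

theorem ActiveWalk.singleton (c : N) : G.ActiveWalk Z [c] c c := by
  refine ⟨rfl, rfl, by simp, ?_⟩
  rintro ⟨a, b, d, h, -⟩
  simpa using h.length_le

theorem ActiveWalk.exists_eq_cons {p : List N} {d c : N} (h : G.ActiveWalk Z p d c) :
    ∃ q, p = d :: q := by
  have := h.head
  cases p with
  | nil => simp at this
  | cons a q => exact ⟨q, by simpa using this⟩

theorem ActiveWalk.cons {q : List N} {u v c : N} (h : G.ActiveWalk Z (v :: q) v c)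
    (huv : G.edge u v ∨ G.edge v u)
    (hne : ∀ a q', q = a :: q' →
      ((G.edge u v ∧ G.edge a v) → v ∈ G.Anc Z) ∧ (¬ (G.edge u v ∧ G.edge a v) → v ∉ Z)) :
    G.ActiveWalk Z (u :: v :: q) u c := by
  refine ⟨rfl, ?_, ?_, ?_⟩
  · simpa using h.last
  · exact List.isChain_cons_cons.2 ⟨huv, h.chain⟩
  · rintro ⟨a, b, d, habd, H⟩
    rcases List.infix_cons_iff.1 habd with hp | hi
    · obtain ⟨q', hq'⟩ := hp
      simp only [List.cons_append, List.nil_append, List.cons.injEq] at hq'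
      obtain ⟨rfl, rfl, rfl⟩ := hq'
      obtain ⟨h1, h2⟩ := hne d q' rfl
      rcases H with ⟨H, hb⟩ | ⟨H, hb⟩
      · refine h2 ?_ hb
        rintro ⟨h3, h4⟩
        rcases H with H | H | H
        · exact G.edge_asymm h4 H.2
        · exact G.edge_asymm h3 H.2
        · exact G.edge_asymm h3 H.1
      · obtain ⟨z, hz, hbz⟩ := h1 H
        exact hb z hz hbz
    · exact h.active ⟨a, b, d, hi, H⟩

theorem ActiveWalk.cons_of_notMem {p : List N} {u v c : N} (h : G.ActiveWalk Z p v c)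
    (huv : G.edge u v ∨ G.edge v u) (hv : v ∉ Z) (hanc : G.edge u v → v ∈ G.Anc Z) :
    G.ActiveWalk Z (u :: p) u c := by
  obtain ⟨q, rfl⟩ := h.exists_eq_cons
  exact h.cons huv fun a q' _ => ⟨fun H => hanc H.1, fun _ => hv⟩

/-- The directed path from `w` to `d`, traversed backwards, is prepended to the walk. None of its
nodes is in `Z`, because `w` has no descendant there, and none becomes a head-to-head node. -/
theorem ActiveWalk.exists_of_descendant {d w : N} (hwd : Relation.ReflTransGen G.edge w d) {c : N}
    (hw : w ∉ G.Anc Z) {p : List N} (h : G.ActiveWalk Z p w c) : ∃ p', G.ActiveWalk Z p' d c := by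
  induction hwd using Relation.ReflTransGen.head_induction_on generalizing p with
  | refl => exact ⟨p, h⟩
  | head hwv _ ih =>
    exact ih (fun hv => hw (G.anc_of_edge hwv hv))
      (h.cons_of_notMem (.inr hwv) (fun hz => hw (G.subset_anc Z hz))
        fun he => absurd he (G.edge_asymm hwv))

theorem ActiveWalk.exists_of_ancestor {w c : N} (hwc : Relation.ReflTransGen G.edge w c)
    (hw : w ∉ G.Anc Z) :
    ∃ q, G.ActiveWalk Z (w :: q) w c ∧ ∀ a q', q = a :: q' → G.edge w a := by
  induction hwc using Relation.ReflTransGen.head_induction_on with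
  | refl => exact ⟨[], .singleton c, by simp⟩
  | head hwv _ ih =>
    obtain ⟨q, hq, hedge⟩ := ih (fun hv => hw (G.anc_of_edge hwv hv))
    refine ⟨_ :: q, hq.cons (.inl hwv) fun a q' h => ?_, ?_⟩
    · have h1 := hedge a q' h
      exact ⟨fun H => absurd H.2 (G.edge_asymm h1),
        fun _ hz => hw (G.anc_of_edge hwv (G.subset_anc Z hz))⟩
    · rintro a q' h
      simp only [List.cons.injEq] at h
      exact h.1 ▸ hwv

/-- A walk that reaches `v` and arrives there at a head-to-head node can be continued to `u`, or
there is an active walk to `d`. -/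
theorem ActiveWalk.exists_of_collider {p : List N} {u v c d : N}
    (hv : v ∈ G.Anc (insert c (insert d Z))) (huv : G.edge u v) (h : G.ActiveWalk Z p v c)
    (hcont : v ∈ G.Anc Z → ∃ p', G.ActiveWalk Z p' u c) :
    (∃ p', G.ActiveWalk Z p' d c) ∨ ∃ p', G.ActiveWalk Z p' u c := by
  by_cases hvZ : v ∈ G.Anc Z
  · exact .inr (hcont hvZ)
  obtain ⟨z, hz, hvz⟩ := hv
  rcases hz with rfl | rfl | hz
  -- If `v` is an ancestor of `c`, the rest of the walk is replaced by a directed path from `v` to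
  -- `c`, so that `v` is no longer head-to-head.
  · obtain ⟨q, hq, hedge⟩ := exists_of_ancestor hvz hvZ
    refine .inr ⟨_, hq.cons (.inl huv) fun a q' h => ?_⟩
    exact ⟨fun H => absurd H.2 (G.edge_asymm (hedge a q' h)),
      fun _ hz => hvZ (G.subset_anc Z hz)⟩
  · exact .inl (exists_of_descendant hvz hvZ h)
  · exact absurd ⟨z, hz, hvz⟩ hvZ

theorem MoralConn.notMem {M : Set N} {c v : N} (hc : c ∉ Z) (h : G.MoralConn M Z c v) : v ∉ Z := by
  cases h <;> assumption

theorem MoralConn.mem {M : Set N} {c v : N} (hc : c ∈ M) (h : G.MoralConn M Z c v) : v ∈ M := by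
  cases h <;> assumption

/-- A moral edge between two parents of `w` becomes a detour through the head-to-head node `w`.
Every head-to-head node created is an ancestor of `Z`, which opens it, or of `c` or `d`, which
allows a directed path to that end to bypass it. A bypass to `d` finishes at once, whence the
disjunction. -/
theorem MoralConn.exists_activeWalk {c d v : N} (hc : c ∉ Z)
    (h : G.MoralConn (G.Anc (insert c (insert d Z))) Z c v) :
    (∃ p, G.ActiveWalk Z p d c) ∨ ∃ p, G.ActiveWalk Z p v c := by
  induction h with
  | refl => exact .inr ⟨_, .singleton c⟩
  | @step v u hv hadj _ _ ih =>
    rcases ih with ih | ⟨p, hp⟩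
    · exact .inl ih
    have hvZ := hv.notMem hc
    rcases hadj with hvu | huv | ⟨w, hw, hvw, huw⟩
    · exact .inr ⟨_, hp.cons_of_notMem (.inr hvu) hvZ fun he => absurd he (G.edge_asymm hvu)⟩
    · exact hp.exists_of_collider (hv.mem (G.subset_anc _ (by simp))) huv
        fun hanc => ⟨_, hp.cons_of_notMem (.inl huv) hvZ fun _ => hanc⟩
    · have hpw := hp.cons_of_notMem (.inr hvw) hvZ fun he => absurd he (G.edge_asymm hvw)
      refine hpw.exists_of_collider hw huw fun hanc => ?_
      obtain ⟨q, rfl⟩ := hp.exists_eq_cons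
      refine ⟨_, hpw.cons (.inl huw) fun a q' h => ?_⟩
      simp only [List.cons.injEq] at h
      obtain ⟨rfl, rfl⟩ := h
      exact ⟨fun _ => hanc, fun H => absurd ⟨huw, hvw⟩ H⟩

theorem infix_triple_append {l₁ l₃ : List N} {v a b c : N} (h : [a, b, c] <:+: l₁ ++ v :: l₃) :
    [a, b, c] <:+: l₁ ++ [v] ∨ [a, b, c] <:+: v :: l₃ ∨
      (b = v ∧ (∃ l, l₁ = l ++ [a]) ∧ ∃ l, l₃ = c :: l) := by
  induction l₁ with
  | nil => exact .inr (.inl h)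
  | cons e l₁ ih =>
    rw [List.cons_append, List.infix_cons_iff] at h
    rcases h with h | h
    · rcases l₁ with _ | ⟨f, _ | ⟨g, l₁⟩⟩
      · obtain ⟨t, ht⟩ := h
        simp only [List.cons_append, List.nil_append, List.cons.injEq] at ht
        obtain ⟨rfl, rfl, rfl⟩ := ht
        exact .inr (.inr ⟨rfl, ⟨[], rfl⟩, ⟨t, rfl⟩⟩)
      all_goals
        obtain ⟨t, ht⟩ := h
        simp only [List.cons_append, List.nil_append, List.cons.injEq] at ht
        obtain ⟨rfl, rfl, rfl, -⟩ := ht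
        refine .inl (List.IsPrefix.isInfix ?_)
        simp
    · rcases ih h with h | h | ⟨rfl, ⟨l, rfl⟩, h'⟩
      · exact .inl (h.trans (List.infix_cons List.infix_rfl))
      · exact .inr (.inl h)
      · exact .inr (.inr ⟨rfl, ⟨e :: l, rfl⟩, h'⟩)

/-- Along an active walk that leaves a node `v` without descendants in `Z` by an outgoing arrow, all
arrows point forward. -/
theorem transGen_of_active {v h : N} {q : List N} (hv : v ∉ G.Anc Z) (hvh : G.edge v h)
    (hchain : (v :: h :: q).IsChain (fun v w => G.edge v w ∨ G.edge w v))
    (hq : ¬ G.Blocked (v :: h :: q) Z) : ∀ w ∈ h :: q, Relation.TransGen G.edge v w := by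
  induction q generalizing v h with
  | nil => simpa using Relation.TransGen.single hvh
  | cons e q ih =>
    have hhZ : h ∉ G.Anc Z := fun H => hv (G.anc_of_edge hvh H)
    have hc' := (List.isChain_cons_cons.1 hchain).2
    have hhe : G.edge h e := by
      refine ((List.isChain_cons_cons.1 hc').1).resolve_right fun heh => ?_
      refine hq ⟨v, h, e, List.IsPrefix.isInfix (by simp), .inr ⟨⟨hvh, heh⟩, ?_⟩⟩
      exact fun z hz hhz => hhZ ⟨z, hz, hhz⟩
    have := ih hhZ hhe hc' fun H => hq (H.mono (List.infix_cons List.infix_rfl))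
    intro w hw
    rcases List.mem_cons.1 hw with rfl | hw
    · exact .single hvh
    · exact .head hvh (this w hw)

/-- Cutting out a loop at `v` creates only one new triple, the one centred at `v`. If that triple
were blocking, the original walk would be blocked at `v` or inside the loop. -/
theorem ActiveWalk.shortcut {l₁ l₂ l₃ : List N} {v d c : N}
    (h : G.ActiveWalk Z (l₁ ++ v :: (l₂ ++ v :: l₃)) d c) :
    G.ActiveWalk Z (l₁ ++ v :: l₃) d c := by
  have hch := h.chain
  have hsuf : v :: l₃ <:+: l₁ ++ v :: (l₂ ++ v :: l₃) := ⟨l₁ ++ v :: l₂, [], by simp⟩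
  have hpre : l₁ ++ [v] <:+: l₁ ++ v :: (l₂ ++ v :: l₃) := ⟨[], l₂ ++ v :: l₃, by simp⟩
  refine ⟨?_, ?_, ?_, ?_⟩
  · have := h.head
    cases l₁ <;> simpa using this
  · have := h.last
    simpa [List.getLast?_append, List.getLast?_cons] using this
  · rw [List.isChain_split] at hch ⊢
    exact ⟨hch.1, hch.2.infix ⟨v :: l₂, [], by simp⟩⟩
  · rintro ⟨a, b, e, habe, H⟩
    rcases infix_triple_append habe with habe | habe | ⟨rfl, ⟨k₁, rfl⟩, ⟨k₃, rfl⟩⟩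
    · exact h.active ⟨a, b, e, habe.trans hpre, H⟩
    · exact h.active ⟨a, b, e, habe.trans hsuf, H⟩
    obtain ⟨f, k, hk⟩ : ∃ f k, l₂ ++ [b] = f :: k := by
      cases l₂ <;> simp
    obtain ⟨k', g, hk'⟩ : ∃ k' g, b :: l₂ = k' ++ [g] :=
      ⟨_, _, (List.dropLast_append_getLast (List.cons_ne_nil b l₂)).symm⟩
    have e1 : k₁ ++ [a] ++ b :: (l₂ ++ b :: e :: k₃) = k₁ ++ [a, b, f] ++ (k ++ e :: k₃) := by
      have : l₂ ++ b :: e :: k₃ = (l₂ ++ [b]) ++ e :: k₃ := by simp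
      rw [this, hk]; simp
    have e2 : k₁ ++ [a] ++ b :: (l₂ ++ b :: e :: k₃) = (k₁ ++ [a] ++ k') ++ [g, b, e] ++ k₃ := by
      have : b :: (l₂ ++ b :: e :: k₃) = (b :: l₂) ++ b :: e :: k₃ := by simp
      rw [this, hk']; simp
    have e3 : k₁ ++ [a] ++ b :: (l₂ ++ b :: e :: k₃) = (k₁ ++ [a]) ++ (b :: f :: k) ++ e :: k₃ := by
      rw [← hk]; simp
    have t1 : [a, b, f] <:+: k₁ ++ [a] ++ b :: (l₂ ++ b :: e :: k₃) := ⟨_, _, e1.symm⟩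
    have t2 : [g, b, e] <:+: k₁ ++ [a] ++ b :: (l₂ ++ b :: e :: k₃) := ⟨_, _, e2.symm⟩
    have t3 : b :: f :: k <:+: k₁ ++ [a] ++ b :: (l₂ ++ b :: e :: k₃) := ⟨_, _, e3.symm⟩
    have c3 := hch.infix t3
    have hbf := (List.isChain_cons_cons.1 c3).1
    have hgb : G.edge g b ∨ G.edge b g := (List.isChain_cons_cons.1 (hch.infix t2)).1
    rcases H with ⟨H, hbZ⟩ | ⟨⟨hab, heb⟩, hdesc⟩
    -- An arrow out of `b` towards `a` or `e` makes `b` a chain or fork node at that visit of the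
    -- original walk too, whichever way the loop edge points.
    · have hout : G.edge b a ∨ G.edge b e := by tauto
      rcases hout with hba | hbe
      · exact h.active ⟨a, b, f, t1, .inl ⟨by tauto, hbZ⟩⟩
      · exact h.active ⟨g, b, e, t2, .inl ⟨by tauto, hbZ⟩⟩
    -- If the loop leaves the closed head-to-head node `b` along an arrow, activity forces all
    -- arrows of the loop forward, giving a directed cycle. Otherwise `b` was already a closed
    -- head-to-head node at its first visit.
    · rcases hbf with hbf | hfb
      · refine G.acyclic b (transGen_of_active (Z := Z) ?_ hbf c3 (fun H => h.active (H.mono t3)) b ?_)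
        · rintro ⟨z, hz, hbz⟩
          exact hdesc z hz hbz
        · rw [← hk]; simp
      · exact h.active ⟨a, b, f, t1, .inr ⟨⟨hab, hfb⟩, hdesc⟩⟩

theorem exists_split_of_not_nodup {p : List N} (h : ¬ p.Nodup) :
    ∃ l₁ v l₂ l₃, p = l₁ ++ v :: (l₂ ++ v :: l₃) := by
  induction p with
  | nil => simp at h
  | cons a p ih =>
    by_cases ha : a ∈ p
    · obtain ⟨s, t, rfl⟩ := List.append_of_mem ha
      exact ⟨[], a, s, t, rfl⟩
    · obtain ⟨l₁, v, l₂, l₃, rfl⟩ := ih fun hp => h (List.nodup_cons.2 ⟨ha, hp⟩)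
      exact ⟨a :: l₁, v, l₂, l₃, rfl⟩

theorem ActiveWalk.exists_isPath {p : List N} {d c : N} (h : G.ActiveWalk Z p d c) :
    ∃ p, G.IsPath p d c ∧ ¬ G.Blocked p Z := by
  induction hn : p.length using Nat.strong_induction_on generalizing p with
  | _ n ih =>
    by_cases hp : p.Nodup
    · exact ⟨p, ⟨h.head, h.last, h.chain, hp⟩, h.active⟩
    · obtain ⟨l₁, v, l₂, l₃, rfl⟩ := exists_split_of_not_nodup hp
      exact ih _ (by subst hn; simp) h.shortcut rfl

/-- d-separated nodes are separated in the moral graph of the ancestral subgraph. -/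
theorem DSep.not_moralConn {c d : N} (h : G.DSep {d} {c} Z) (hc : c ∉ Z) :
    ¬ G.MoralConn (G.Anc (insert c (insert d Z))) Z c d := by
  intro hconn
  obtain ⟨p, hp⟩ : ∃ p, G.ActiveWalk Z p d c := by
    rcases hconn.exists_activeWalk hc with h | h <;> exact h
  obtain ⟨p, hp, hact⟩ := hp.exists_isPath
  exact hact (h d rfl c rfl p hp)

end DAG

/-! ### The common nodes of the two wings -/

namespace DAG

variable {N : Type*} {G : DAG N} {a b x y : N}

theorem parents_subset_anc {Z : Set N} {v : N} (hv : v ∈ G.Anc Z) : G.parents v ⊆ G.Anc Z :=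
  fun _ hu => G.anc_of_edge hu hv

/-- The nodes that are morally connected both to `a` without passing `x` and to `b` without
passing `y`. -/
def common (G : DAG N) (a b x y : N) : Set N :=
  {v | G.MoralConn (G.Anc {a, y, x}) {x} a v ∧ G.MoralConn (G.Anc {b, x, y}) {y} b v}

/-- The nodes `a` and `y` are separated by `x`, and `b` and `x` are separated by `y`, in the
moral graphs of the respective ancestral subgraphs. -/
structure LocallySeparated (G : DAG N) (a b x y : N) : Prop where
  hax : a ≠ x
  hby : b ≠ y
  hxy : x ≠ y
  not_left : ¬ G.MoralConn (G.Anc {a, y, x}) {x} a y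
  not_right : ¬ G.MoralConn (G.Anc {b, x, y}) {y} b x

namespace LocallySeparated

/-- Along a directed path to `x` or `y`, every node lies in both ancestral subgraphs, so both
connections propagate along the path. They would reach its endpoint, against one of the separations.
-/
theorem common_not_anc (h : G.LocallySeparated a b x y) {v : N} (hv : v ∈ G.common a b x y) :
    v ∉ G.Anc {x, y} := by
  rintro ⟨z, hz, hvz⟩
  induction hvz using Relation.ReflTransGen.head_induction_on with
  | refl =>
    rcases hz with rfl | rfl
    · exact h.not_right hv.2
    · exact h.not_left hv.1
  | @head v w hvw hwz ih =>
    have h1 : w ∈ G.Anc {a, y, x} := ⟨z, by rcases hz with rfl | rfl <;> simp, hwz⟩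
    have h2 : w ∈ G.Anc {b, x, y} := ⟨z, by rcases hz with rfl | rfl <;> simp, hwz⟩
    have hwx : w ≠ x := by
      rintro rfl
      exact h.not_right (hv.2.step (.inl hvw) h2 h.hxy)
    have hwy : w ≠ y := by
      rintro rfl
      exact h.not_left (hv.1.step (.inl hvw) h1 hwx)
    exact ih ⟨hv.1.step (.inl hvw) h1 hwx, hv.2.step (.inl hvw) h2 hwy⟩

theorem notMem_of_common (h : G.LocallySeparated a b x y) {v : N} (hv : v ∈ G.common a b x y) :
    v ≠ x ∧ v ≠ y := by
  constructor <;> rintro rfl <;> exact h.common_not_anc hv (G.subset_anc _ (by simp))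

theorem left_mem (_h : G.LocallySeparated a b x y) {v : N}
    (hv : G.MoralConn (G.Anc {a, y, x}) {x} a v) : v ∈ G.Anc {a, y, x} :=
  hv.mem (G.subset_anc _ (by simp))

theorem right_mem (_h : G.LocallySeparated a b x y) {v : N}
    (hv : G.MoralConn (G.Anc {b, x, y}) {y} b v) : v ∈ G.Anc {b, x, y} :=
  hv.mem (G.subset_anc _ (by simp))

theorem parents_subset_common (h : G.LocallySeparated a b x y) {v : N}
    (hv : v ∈ G.common a b x y) : G.parents v ⊆ G.common a b x y := by
  intro u hu
  have h1 := parents_subset_anc (h.left_mem hv.1) hu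
  have h2 := parents_subset_anc (h.right_mem hv.2) hu
  have hux : u ≠ x := by
    rintro rfl
    exact h.not_right (hv.2.step (.inr (.inl hu)) h2 h.hxy)
  have huy : u ≠ y := by
    rintro rfl
    exact h.not_left (hv.1.step (.inr (.inl hu)) h1 hux)
  exact ⟨hv.1.step (.inr (.inl hu)) h1 hux, hv.2.step (.inr (.inl hu)) h2 huy⟩

theorem common_closed (h : G.LocallySeparated a b x y) {v u : N} (hv : v ∈ G.common a b x y)
    (hu : u ∈ G.common a b x y ∪ G.Anc {x, y})
    (hadj : G.MoralAdj (G.common a b x y ∪ G.Anc {x, y}) v u) : u ∈ G.common a b x y := by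
  rcases hadj with hvu | huv | ⟨w, hw, hvw, huw⟩
  · exact hu.resolve_right fun H => h.common_not_anc hv (G.anc_of_edge hvu H)
  · exact h.parents_subset_common hv huv
  · exact h.parents_subset_common
      (hw.resolve_right fun H => h.common_not_anc hv (G.anc_of_edge hvw H)) huw

theorem right_of_anc (h : G.LocallySeparated a b x y) {v : N} (hv : v ∈ G.Anc {b})
    (hv' : v ∉ G.Anc {x, y}) : G.MoralConn (G.Anc {b, x, y}) {y} b v := by
  obtain ⟨_, rfl, hvb⟩ := hv
  induction hvb using Relation.ReflTransGen.head_induction_on with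
  | refl => exact .refl
  | @head v w hvw hwb ih =>
    refine (ih fun H => hv' (G.anc_of_edge hvw H)).step (.inr (.inl hvw))
      ⟨_, by simp, .head hvw hwb⟩ ?_
    rintro rfl
    exact hv' (G.subset_anc _ (by simp))

/-- Enlarging the ancestral subgraph by the ancestors of `b` could only add moral edges at `v`
through a new child `w`. Such a `w` is an ancestor of `b` but not of `x` or `y`, so `w` and then `v`
are connected to `b`, which would put `v` in `common`. -/
theorem left_closed (h : G.LocallySeparated a b x y) {v u : N}
    (hv : G.MoralConn (G.Anc {a, y, x}) {x} a v) (hvW : v ∉ G.common a b x y)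
    (hux : u ≠ x) (hadj : G.MoralAdj (G.Anc {a, b, x, y}) v u)
    (hu : u ∈ G.Anc {a, b, x, y}) : G.MoralConn (G.Anc {a, y, x}) {x} a u := by
  have key : ∀ w ∈ G.Anc {a, b, x, y}, G.edge v w → w ∈ G.Anc {a, y, x} := by
    rintro w ⟨z, hz, hwz⟩ hvw
    by_contra hw
    have hwxy : w ∉ G.Anc {x, y} := fun H => hw (G.anc_mono (by
      rintro _ (rfl | rfl) <;> simp) H)
    have hzb : z = b := by
      simp only [Set.mem_insert_iff, Set.mem_singleton_iff] at hz
      rcases hz with rfl | rfl | rfl | rfl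
      · exact absurd ⟨z, by simp, hwz⟩ hw
      · rfl
      · exact absurd ⟨z, by simp, hwz⟩ hw
      · exact absurd ⟨z, by simp, hwz⟩ hw
    subst hzb
    refine hvW ⟨hv, (h.right_of_anc ⟨z, rfl, hwz⟩ hwxy).step (.inr (.inl hvw))
      ⟨z, by simp, .head hvw hwz⟩ ?_⟩
    rintro rfl
    exact h.not_left hv
  rcases hadj with hvu | huv | ⟨w, hw, hvw, huw⟩
  · exact hv.step (.inl hvu) (key u hu hvu) hux
  · exact hv.step (.inr (.inl huv)) (parents_subset_anc (h.left_mem hv) huv) hux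
  · have hw' := key w hw hvw
    exact hv.step (.inr (.inr ⟨w, hw', hvw, huw⟩)) (parents_subset_anc hw' huw) hux

end LocallySeparated

end DAG

/-! ### Marginals and conditional independence -/

section Marginals

open Classical in
/-- Summation over all values of the variable `v`. -/
noncomputable def sumOut {N : Type*} {T : N → Type*} (v : N) (f : (∀ v, T v) → ENNReal) :
    (∀ v, T v) → ENNReal :=
  fun x => ∑' t, f (Function.update x v t)

/-- The value of `f` does not depend on the variable `v`. -/
def IndepOf {N : Type*} {T : N → Type*} (f : (∀ v, T v) → ENNReal) (v : N) : Prop :=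
  ∀ x x' : ∀ v, T v, (∀ u, u ≠ v → x u = x' u) → f x = f x'

variable {N : Type*} {T : N → Type*} (P : PMF (∀ v, T v))

theorem toOuterMeasure_eq_tsum_fiber {α β : Type*} (p : PMF α) (f : α → β) (s : Set α) :
    p.toOuterMeasure s = ∑' t, p.toOuterMeasure {ω | ω ∈ s ∧ f ω = t} := by
  simp only [PMF.toOuterMeasure_apply]
  rw [ENNReal.tsum_comm]
  refine tsum_congr fun ω => ?_
  rw [tsum_eq_single (f ω)]
  · by_cases h : ω ∈ s <;> simp [Set.indicator, h]
  · intro t ht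
    exact Set.indicator_of_notMem (fun h => ht h.2.symm) _

theorem toOuterMeasure_ne_top {α : Type*} (p : PMF α) (s : Set α) : p.toOuterMeasure s ≠ ⊤ := by
  refine ne_top_of_le_ne_top ENNReal.one_ne_top ?_
  rw [PMF.toOuterMeasure_apply, ← p.tsum_coe]
  exact ENNReal.tsum_le_tsum fun a => Set.indicator_le_self _ _ a

theorem marg_ne_top (s : Set N) (x : ∀ v, T v) : marg P s x ≠ ⊤ := toOuterMeasure_ne_top _ _

theorem marg_congr {s : Set N} {x x' : ∀ v, T v} (h : ∀ v ∈ s, x v = x' v) :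
    marg P s x = marg P s x' := by
  unfold marg
  congr 1
  ext ω
  exact forall₂_congr fun v hv => by rw [h v hv]

theorem marg_empty (x : ∀ v, T v) : marg P ∅ x = 1 := by
  simp [marg, PMF.toOuterMeasure_apply, P.tsum_coe]

theorem marg_univ (x : ∀ v, T v) : marg P Set.univ x = P x := by
  have : {ω : ∀ v, T v | ∀ v ∈ Set.univ, ω v = x v} = {x} := by
    ext ω; simp [funext_iff]
  rw [marg, this, PMF.toOuterMeasure_apply_singleton]

theorem marg_anti {s t : Set N} (h : s ⊆ t) (x : ∀ v, T v) : marg P t x ≤ marg P s x :=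
  MeasureTheory.measure_mono (μ := P.toOuterMeasure) fun _ hω v hv => hω v (h hv)

theorem sumOut_marg {v : N} {M : Set N} (hv : v ∉ M) :
    sumOut v (marg P (insert v M)) = marg P M := by
  funext x
  rw [sumOut, marg, toOuterMeasure_eq_tsum_fiber P (fun ω => ω v)]
  refine tsum_congr fun t => ?_
  unfold marg
  congr 1
  ext ω
  simp only [Set.mem_ofPred_eq, Set.forall_mem_insert, Function.update_self]
  rw [and_comm]
  refine and_congr_left fun _ => forall₂_congr fun u hu => ?_
  have huv : u ≠ v := by rintro rfl; exact hv hu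
  simp [huv]

theorem indepOf_marg {v : N} {M : Set N} (hv : v ∉ M) : IndepOf (marg P M) v :=
  fun _ _ h => marg_congr P fun u hu => h u fun huv => hv (huv ▸ hu)

theorem indepOf_condProb {v : N} {s t : Set N} (hs : v ∉ s) (ht : v ∉ t) :
    IndepOf (condProb P s t) v := fun x x' h => by
  unfold condProb
  rw [indepOf_marg P (by simp [hs, ht]) x x' h, indepOf_marg P ht x x' h]

theorem IndepOf.update [DecidableEq N] {f : (∀ v, T v) → ENNReal} {v : N} (h : IndepOf f v)
    (x : ∀ v, T v) (t : T v) : f (Function.update x v t) = f x :=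
  h _ _ fun _ hu => Function.update_of_ne hu _ _

theorem IndepOf.prod {ι : Type*} {s : Finset ι} {f : ι → (∀ v, T v) → ENNReal} {v : N}
    (h : ∀ i ∈ s, IndepOf (f i) v) : IndepOf (∏ i ∈ s, f i) v := fun x x' hx => by
  simp only [Finset.prod_apply]
  exact Finset.prod_congr rfl fun i hi => h i hi x x' hx

theorem IndepOf.sumOut {f : (∀ v, T v) → ENNReal} {u : N} (hf : IndepOf f u) (v : N) :
    IndepOf (sumOut v f) u := fun x x' h => by
  classical
  refine tsum_congr fun t => hf _ _ fun w hw => ?_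
  by_cases hwv : w = v
  · subst hwv; simp
  · simp [Function.update_of_ne hwv, h w hw]

theorem IndepOf.foldr_sumOut {f : (∀ v, T v) → ENNReal} {u : N} (hf : IndepOf f u) (l : List N) :
    IndepOf (l.foldr BellCausal.sumOut f) u := by
  induction l with
  | nil => exact hf
  | cons v l ih => exact ih.sumOut v

theorem foldr_sumOut_mul_left {f : (∀ v, T v) → ENNReal} {l : List N} (hf : ∀ v ∈ l, IndepOf f v)
    (g : (∀ v, T v) → ENNReal) : l.foldr sumOut (f * g) = f * l.foldr sumOut g := by
  classical
  induction l with
  | nil => rfl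
  | cons v l ih =>
    rw [List.foldr_cons, ih fun u hu => hf u (List.mem_cons_of_mem _ hu), List.foldr_cons]
    funext x
    simp only [sumOut, Pi.mul_apply, (hf v List.mem_cons_self).update, ENNReal.tsum_mul_left]

theorem foldr_sumOut_mul_right {g : (∀ v, T v) → ENNReal} {l : List N}
    (hg : ∀ v ∈ l, IndepOf g v) (f : (∀ v, T v) → ENNReal) :
    l.foldr sumOut (f * g) = l.foldr sumOut f * g := by
  rw [mul_comm, foldr_sumOut_mul_left hg, mul_comm]

theorem foldr_sumOut_marg {l : List N} (hl : l.Nodup) {M : Set N} (hM : ∀ v ∈ l, v ∉ M) :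
    l.foldr sumOut (marg P ({v | v ∈ l} ∪ M)) = marg P M := by
  induction l generalizing M with
  | nil => simp
  | cons v l ih =>
    rw [List.nodup_cons] at hl
    have e : {u | u ∈ v :: l} ∪ M = {u | u ∈ l} ∪ insert v M := by
      ext u; simp only [List.mem_cons, Set.mem_union, Set.mem_ofPred_eq, Set.mem_insert_iff]; tauto
    rw [List.foldr_cons, e, ih hl.2, sumOut_marg P (hM v List.mem_cons_self)]
    intro u hu
    rw [Set.mem_insert_iff, not_or]
    exact ⟨fun h => hl.1 (h ▸ hu), hM u (List.mem_cons_of_mem _ hu)⟩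

/-- An enumeration of a set of variables. -/
noncomputable def enum [Finite N] (s : Set N) : List N := s.toFinite.toFinset.toList

theorem mem_enum [Finite N] {s : Set N} {v : N} : v ∈ enum s ↔ v ∈ s := by simp [enum]

theorem foldr_enum_marg [Finite N] {s M : Set N} (h : Disjoint s M) :
    (enum s).foldr sumOut (marg P (s ∪ M)) = marg P M := by
  have := foldr_sumOut_marg P (l := enum s) (Finset.nodup_toList _)
    (M := M) fun v hv => Set.disjoint_left.1 h (mem_enum.1 hv)
  simpa only [mem_enum, Set.ofPred_mem_eq] using this

variable {P}

theorem CondIndep.symm {C D E : Set N} (h : CondIndep P C D E) : CondIndep P D C E := fun x => by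
  rw [Set.union_comm D C, h x, mul_comm]

theorem CondIndep.mono_left [Finite N] {C C' D E : Set N} (h : CondIndep P C D E) (hC : C' ⊆ C)
    (hCD : Disjoint C D) (hCE : Disjoint C E) : CondIndep P C' D E := by
  have hd : ∀ v ∈ enum (C \ C'), v ∉ C' ∧ v ∉ D ∧ v ∉ E := fun v hv =>
    have := mem_enum.1 hv
    ⟨this.2, Set.disjoint_left.1 hCD this.1, Set.disjoint_left.1 hCE this.1⟩
  have h' : marg P (C ∪ D ∪ E) * marg P E = marg P (C ∪ E) * marg P (D ∪ E) := funext h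
  have e1 : C ∪ D ∪ E = (C \ C') ∪ (C' ∪ D ∪ E) := by
    rw [← Set.union_assoc, ← Set.union_assoc, Set.sdiff_union_of_subset hC]
  have e2 : C ∪ E = (C \ C') ∪ (C' ∪ E) := by
    rw [← Set.union_assoc, Set.sdiff_union_of_subset hC]
  have := congrArg (fun f => (enum (C \ C')).foldr sumOut f) h'
  rw [foldr_sumOut_mul_right (fun v hv => indepOf_marg P (hd v hv).2.2),
    foldr_sumOut_mul_right (fun v hv => indepOf_marg P (by simp [hd v hv])), e1, e2,
    foldr_enum_marg, foldr_enum_marg] at this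
  · exact congrFun this
  · exact Set.disjoint_left.2 fun v hv => by simp [hd v (mem_enum.2 hv)]
  · exact Set.disjoint_left.2 fun v hv => by simp [hd v (mem_enum.2 hv)]

theorem CondIndep.mono [Finite N] {C C' D D' E : Set N} (h : CondIndep P C D E) (hC : C' ⊆ C)
    (hD : D' ⊆ D) (hCD : Disjoint C D) (hCE : Disjoint C E) (hDE : Disjoint D E) :
    CondIndep P C' D' E :=
  ((h.mono_left hC hCD hCE).symm.mono_left hD (hCD.symm.mono_right hC) hDE).symm

/-- Summing `f * g` over `C`, over `D` or over both gives `F * g`, `f * K` and `F * K`, and (f g)(F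
K) = (f K)(F g). -/
theorem condIndep_of_marg_eq_mul [Finite N] {C D E : Set N} {f g : (∀ v, T v) → ENNReal}
    (h : marg P (C ∪ D ∪ E) = f * g) (hf : ∀ v ∈ D, IndepOf f v) (hg : ∀ v ∈ C, IndepOf g v)
    (hCD : Disjoint C D) (hCE : Disjoint C E) (hDE : Disjoint D E) : CondIndep P C D E := by
  have hf' : ∀ v ∈ enum D, IndepOf f v := fun v hv => hf v (mem_enum.1 hv)
  have hg' : ∀ v ∈ enum C, IndepOf g v := fun v hv => hg v (mem_enum.1 hv)
  set F := (enum C).foldr sumOut f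
  set K := (enum D).foldr sumOut g
  have h1 : marg P (C ∪ E) = f * K := by
    rw [← foldr_sumOut_mul_left hf', ← h, ← foldr_enum_marg P (s := D) (M := C ∪ E)]
    · congr 2
      rw [Set.union_comm C D, Set.union_assoc]
    · exact Set.disjoint_union_right.2 ⟨hCD.symm, hDE⟩
  have h2 : marg P (D ∪ E) = F * g := by
    rw [← foldr_sumOut_mul_right hg', ← h, Set.union_assoc, foldr_enum_marg]
    exact Set.disjoint_union_right.2 ⟨hCD, hCE⟩
  have h3 : marg P E = F * K := by
    rw [← foldr_sumOut_mul_right (fun v hv => (hg' v hv).foldr_sumOut _), ← h1, foldr_enum_marg]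
    exact hCE
  intro x
  rw [h, h1, h2, h3]
  simp only [Pi.mul_apply]
  ring

end Marginals

/-! ### Factorisation over parent-closed sets and the Markov property -/

namespace DAG

variable {N : Type*} {T : N → Type*} {G : DAG N} {P : PMF (∀ v, T v)}

theorem notMem_parents (v : N) : v ∉ G.parents v := fun h => G.acyclic v (.single h)

/-- Equality fails when the parents' values have probability zero, since `condProb` is then `0`. -/
theorem sumOut_condProb_le_one (v : N) (x : ∀ v, T v) :
    sumOut v (condProb P {v} (G.parents v)) x ≤ 1 := by
  classical
  have hv := G.notMem_parents v
  have h := congrFun (sumOut_marg P hv) x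
  simp only [sumOut, condProb, Set.singleton_union, (indepOf_marg P hv).update, div_eq_mul_inv,
    ENNReal.tsum_mul_right] at h ⊢
  rw [h]
  exact ENNReal.div_self_le_one

theorem exists_minimal_of_nonempty [Finite N] {s : Set N} (hs : s.Nonempty) :
    ∃ v ∈ s, ∀ u ∈ s, ¬ G.edge u v := by
  have : IsTrans N (Relation.TransGen G.edge) := ⟨fun _ _ _ => .trans⟩
  have : Std.Irrefl (Relation.TransGen G.edge) := ⟨G.acyclic⟩
  obtain ⟨v, hv, h⟩ := (Finite.wellFounded_of_trans_of_irrefl (Relation.TransGen G.edge)).has_min s hs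
  exact ⟨v, hv, fun u hu he => h u hu (.single he)⟩

theorem exists_maximal_of_nonempty [Finite N] {s : Set N} (hs : s.Nonempty) :
    ∃ v ∈ s, ∀ u ∈ s, ¬ G.edge v u := by
  let r : N → N → Prop := fun u v => Relation.TransGen G.edge v u
  have : IsTrans N r := ⟨fun _ _ _ h h' => Relation.TransGen.trans h' h⟩
  have : Std.Irrefl r := ⟨G.acyclic⟩
  obtain ⟨v, hv, h⟩ := (Finite.wellFounded_of_trans_of_irrefl r).has_min s hs
  exact ⟨v, hv, fun u hu he => h u hu (.single he)⟩

open Classical in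
theorem sumOut_prod_condProb {M : Finset N} (hM : ∀ v ∈ M, G.parents v ⊆ M) {v : N} (hv : v ∉ M)
    (x : ∀ v, T v) :
    sumOut v (fun x => ∏ u ∈ insert v M, condProb P {u} (G.parents u) x) x =
      sumOut v (condProb P {v} (G.parents v)) x * ∏ u ∈ M, condProb P {u} (G.parents u) x := by
  simp only [sumOut, Finset.prod_insert hv]
  rw [← ENNReal.tsum_mul_right]
  refine tsum_congr fun t => ?_
  congr 1
  refine Finset.prod_congr rfl fun u hu => (indepOf_condProb P ?_ ?_).update _ _
  · rintro rfl; exact hv hu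
  · exact fun h => hv (hM u hu h)

variable [Fintype N]

-- Nodes are summed out from the full set down to `M`. The node removed has all its parents in the
-- smaller set, so only its own factor depends on it, and that factor sums to at most `1`.
open Classical in
theorem Compatible.marg_le (h : G.Compatible P) {M : Finset N} (hM : ∀ v ∈ M, G.parents v ⊆ M)
    (x : ∀ v, T v) : marg P M x ≤ ∏ v ∈ M, condProb P {v} (G.parents v) x := by
  induction hn : Mᶜ.card generalizing M x with
  | zero =>
    obtain rfl : M = Finset.univ := by simpa using hn
    rw [Finset.coe_univ, marg_univ, h x]
  | succ n ih =>
    obtain ⟨v, hv, hmin⟩ := G.exists_minimal_of_nonempty (s := (M : Set N)ᶜ) (by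
      have : Mᶜ.Nonempty := Finset.card_pos.1 (by omega)
      simpa [← Finset.coe_compl] using this)
    have hvM : v ∉ M := by simpa using hv
    have hpar : ∀ u ∈ insert v M, G.parents u ⊆ (insert v M : Finset N) := by
      intro u hu w hw
      rcases Finset.mem_insert.1 hu with rfl | hu
      · by_contra hwM
        exact hmin w (by simp_all) hw
      · simpa using Or.inr (hM u hu hw)
    have hcard : (insert v M)ᶜ.card = n := by
      rw [Finset.card_compl] at hn ⊢
      rw [Finset.card_insert_of_notMem hvM]; omega
    calc marg P M x = sumOut v (marg P (insert v M : Finset N)) x := by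
          rw [Finset.coe_insert, sumOut_marg P (by simpa using hvM)]
      _ ≤ sumOut v (fun x => ∏ u ∈ insert v M, condProb P {u} (G.parents u) x) x :=
          ENNReal.tsum_le_tsum fun t => ih hpar _ hcard
      _ ≤ _ := by
          rw [sumOut_prod_condProb hM hvM]
          exact mul_le_of_le_one_left' (sumOut_condProb_le_one v x)

open Classical in
/-- Over a set of nodes that contains the parents of its elements, the marginal distribution is the
product of the conditional probabilities of the variables given their parents. -/
theorem Compatible.marg_eq_prod (h : G.Compatible P) {M : Finset N}
    (hM : ∀ v ∈ M, G.parents v ⊆ M) (x : ∀ v, T v) :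
    marg P M x = ∏ v ∈ M, condProb P {v} (G.parents v) x := by
  induction hn : M.card generalizing M x with
  | zero =>
    obtain rfl : M = ∅ := by simpa using hn
    simp [marg_empty]
  | succ n ih =>
    obtain ⟨v, hv, hmax⟩ := G.exists_maximal_of_nonempty (s := (M : Set N)) (by
      simpa using Finset.card_pos.1 (by omega : 0 < M.card))
    obtain ⟨M', hvM, rfl⟩ : ∃ M', v ∉ M' ∧ M = insert v M' :=
      ⟨M.erase v, by simp, (Finset.insert_erase hv).symm⟩
    have hpar : ∀ u ∈ M', G.parents u ⊆ M' := by
      intro u hu w hw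
      have := hM u (Finset.mem_insert_of_mem hu) hw
      rw [Finset.mem_coe, Finset.mem_insert] at this
      rcases this with rfl | this
      · exact absurd hw (hmax u (by simp [hu]))
      · exact this
    have hM' := ih hpar x (by rw [Finset.card_insert_of_notMem hvM] at hn; omega)
    have hsum : ∑' t, marg P (insert v M' : Finset N) (Function.update x v t) = marg P M' x := by
      rw [← sumOut_marg P (M := (M' : Set N)) (by simpa using hvM), Finset.coe_insert]
      rfl
    have hle : ∑' t, ∏ u ∈ insert v M', condProb P {u} (G.parents u) (Function.update x v t) ≤
        marg P M' x := by
      have := sumOut_prod_condProb (P := P) hpar hvM x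
      rw [sumOut] at this
      rw [this, hM']
      exact mul_le_of_le_one_left' (sumOut_condProb_le_one v x)
    -- Both sides are summed over the value of `v`. The marginal is termwise at most the product,
    -- and the products sum to no more than the marginals, so a strict inequality at one value is
    -- impossible.
    by_contra hne
    have hlt := lt_of_le_of_ne (h.marg_le hM x) hne
    refine (ENNReal.tsum_lt_tsum (i := x v) (hsum ▸ marg_ne_top P _ x)
      (fun t => h.marg_le hM (Function.update x v t)) ?_).not_ge (hle.trans hsum.ge)
    simpa using hlt

/-- A set of nodes that is separated from its complement in the moral graph of an ancestral
subgraph is conditionally independent from it. -/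
theorem Compatible.condIndep_of_moral_closed (h : G.Compatible P) {M S Z : Set N}
    (hM : ∀ v ∈ M, G.parents v ⊆ M) (hSM : S ⊆ M) (hZM : Z ⊆ M) (hSZ : Disjoint S Z)
    (hS : ∀ v ∈ S, ∀ u ∈ M, u ∉ Z → G.MoralAdj M v u → u ∈ S) :
    CondIndep P S (M \ (S ∪ Z)) Z := by
  classical
  have hM' : S ∪ M \ (S ∪ Z) ∪ Z = M.toFinset := by
    ext v
    have h1 := @hSM v
    have h2 := @hZM v
    simp only [Set.mem_union, Set.mem_sdiff, Set.coe_toFinset]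
    tauto
  -- These are the nodes of `M` whose factor involves a variable of `S`. The variables of one factor
  -- are pairwise morally adjacent, so such a factor involves nothing outside `S ∪ Z`.
  let c : N → Prop := fun v => v ∈ S ∨ ∃ u ∈ S, G.edge u v
  refine condIndep_of_marg_eq_mul
    (f := ∏ v ∈ M.toFinset with c v, condProb P {v} (G.parents v))
    (g := ∏ v ∈ M.toFinset with ¬ c v, condProb P {v} (G.parents v)) ?_ ?_ ?_ ?_ hSZ ?_
  · funext x
    rw [Finset.prod_filter_mul_prod_filter_not, hM', Finset.prod_apply]
    exact h.marg_eq_prod (by simpa using hM) x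
  · rintro u ⟨huM, huSZ⟩
    simp only [Set.mem_union, not_or] at huSZ
    refine IndepOf.prod fun v hv => ?_
    simp only [Finset.mem_filter, Set.mem_toFinset] at hv
    obtain ⟨hvM, hvc⟩ := hv
    refine indepOf_condProb P ?_ ?_
    · rintro rfl
      rcases hvc with hvS | ⟨s, hs, hsv⟩
      · exact huSZ.1 hvS
      · exact huSZ.1 (hS s hs u huM huSZ.2 (.inl hsv))
    · intro huv
      rcases hvc with hvS | ⟨s, hs, hsv⟩
      · exact huSZ.1 (hS v hvS u huM huSZ.2 (.inr (.inl huv)))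
      · exact huSZ.1 (hS s hs u huM huSZ.2 (.inr (.inr ⟨v, hvM, hsv, huv⟩)))
  · intro u hu
    refine IndepOf.prod fun v hv => ?_
    simp only [Finset.mem_filter, Set.mem_toFinset] at hv
    obtain ⟨hvM, hvc⟩ := hv
    refine indepOf_condProb P ?_ ?_
    · rintro rfl
      exact hvc (.inl hu)
    · exact fun huv => hvc (.inr ⟨u, hu, huv⟩)
  · exact Set.disjoint_left.2 fun v hv hv' => hv'.2 (.inl hv)
  · exact Set.disjoint_left.2 fun v hv hv' => hv.2 (.inr hv')

end DAG

/-! ### Conditional laws and the local decomposition -/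

theorem exists_condLaw {α β : Type*} (p : PMF α) (f : α → β) (E : Set α) :
    ∃ κ : PMF β, ∀ t, p.toOuterMeasure E * κ t = p.toOuterMeasure {ω | ω ∈ E ∧ f ω = t} := by
  classical
  by_cases hE : p.toOuterMeasure E = 0
  -- Given a null event, any law will do.
  · refine ⟨p.map f, fun t => ?_⟩
    rw [hE, zero_mul, eq_comm]
    exact MeasureTheory.measure_mono_null (μ := p.toOuterMeasure) (fun _ hω => hω.1) hE
  have hs : ∃ a ∈ E, a ∈ p.support := by
    by_contra! h
    exact hE ((p.toOuterMeasure_apply_eq_zero_iff E).2 (Set.disjoint_left.2 fun a ha ha' => h a ha' ha))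
  refine ⟨(p.filter E hs).map f, fun t => ?_⟩
  rw [PMF.map_apply, ← ENNReal.tsum_mul_left, PMF.toOuterMeasure_apply p {ω | ω ∈ E ∧ f ω = t}]
  refine tsum_congr fun ω => ?_
  have hE' : ∑' a, E.indicator p a ≠ 0 := by rwa [PMF.toOuterMeasure_apply] at hE
  have hE'' : ∑' a, E.indicator p a ≠ ⊤ := by
    rw [← PMF.toOuterMeasure_apply]; exact toOuterMeasure_ne_top p E
  rw [PMF.filter_apply, PMF.toOuterMeasure_apply p E]
  by_cases h1 : ω ∈ E <;> by_cases h2 : f ω = t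
  · rw [if_pos h2.symm, mul_comm, mul_assoc, ENNReal.inv_mul_cancel hE' hE'', mul_one]
    simp [Set.indicator, h1, h2]
  · simp [Set.indicator, h1, h2, Ne.symm h2]
  all_goals simp [Set.indicator, h1]

section

variable {N : Type*} {T : N → Type*} {G : DAG N} {P : PMF (∀ v, T v)} {a b x y : N}

theorem DAG.LocallySeparated.symm (h : G.LocallySeparated a b x y) :
    G.LocallySeparated b a y x :=
  ⟨h.hby, h.hax, h.hxy.symm, h.not_right, h.not_left⟩

theorem DAG.common_symm : G.common b a y x = G.common a b x y :=
  Set.ext fun _ => and_comm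

theorem DAG.LocallySeparated.ne_right (h : G.LocallySeparated a b x y) : b ≠ x := by
  rintro rfl
  exact h.not_right .refl

theorem marg_eq_toOuterMeasure {s : Set N} {ω₀ : ∀ v, T v} {E : Set (∀ v, T v)}
    (h : ∀ ω, (∀ v ∈ s, ω v = ω₀ v) ↔ ω ∈ E) : marg P s ω₀ = P.toOuterMeasure E := by
  unfold marg
  congr 1
  exact Set.ext h

/-- The restriction of an assignment to a set of variables. -/
def res (s : Set N) (ω : ∀ v, T v) (v : s) : T v := ω v

theorem res_eq_iff {s : Set N} {ω ω' : ∀ v, T v} : res s ω = res s ω' ↔ ∀ v ∈ s, ω v = ω' v :=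
  ⟨fun h v hv => congrFun h ⟨v, hv⟩, fun h => funext fun v => h v v.2⟩

variable [Fintype N]

theorem DAG.LocallySeparated.condIndep_left (h : G.LocallySeparated a b x y)
    (hP : G.Compatible P) : CondIndep P (insert a (G.common a b x y)) {y} {x} := by
  have hd : Disjoint {v | G.MoralConn (G.Anc {a, y, x}) {x} a v} {x} :=
    Set.disjoint_singleton_right.2 fun H => H.notMem (Z := {x}) h.hax rfl
  refine CondIndep.mono (hP.condIndep_of_moral_closed (M := G.Anc {a, y, x})
    (S := {v | G.MoralConn (G.Anc {a, y, x}) {x} a v}) (Z := {x})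
    (fun v hv => DAG.parents_subset_anc hv) (fun v hv => h.left_mem hv)
    (Set.singleton_subset_iff.2 (G.subset_anc _ (by simp))) hd
    (fun v hv u huM hu hadj => DAG.MoralConn.step hv hadj huM hu)) ?_ ?_ ?_ hd ?_
  · rintro v (rfl | hv)
    · exact .refl
    · exact hv.1
  · rintro _ rfl
    refine ⟨G.subset_anc _ (by simp), ?_⟩
    rintro (H | H)
    · exact h.not_left H
    · exact h.hxy H.symm
  · exact Set.disjoint_left.2 fun v hv hv' => hv'.2 (.inl hv)
  · exact Set.disjoint_left.2 fun v hv hv' => hv.2 (.inr hv')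

theorem DAG.LocallySeparated.condIndep_common (h : G.LocallySeparated a b x y)
    (hP : G.Compatible P) : CondIndep P (G.common a b x y) {x, y} ∅ := by
  have hd : Disjoint (G.common a b x y) ∅ := Set.disjoint_empty _
  refine CondIndep.mono (hP.condIndep_of_moral_closed (M := G.common a b x y ∪ G.Anc {x, y})
    (S := G.common a b x y) (Z := ∅) ?_ Set.subset_union_left (Set.empty_subset _) hd
    (fun v hv u huM _ hadj => h.common_closed hv huM hadj)) subset_rfl ?_ ?_ hd
      (Set.disjoint_empty _)
  · rintro v (hv | hv)
    · exact (h.parents_subset_common hv).trans Set.subset_union_left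
    · exact (DAG.parents_subset_anc hv).trans Set.subset_union_right
  · intro v hv
    refine ⟨.inr (G.subset_anc _ hv), ?_⟩
    rintro (H | H)
    · exact h.common_not_anc H (G.subset_anc _ hv)
    · exact H
  · exact Set.disjoint_left.2 fun v hv hv' => hv'.2 (.inl hv)

theorem DAG.LocallySeparated.condIndep_outcomes (h : G.LocallySeparated a b x y)
    (hP : G.Compatible P) : CondIndep P {a} {b} ({x, y} ∪ G.common a b x y) := by
  -- If `a` or `b` is itself a common node, it is part of the condition and the independence is
  -- trivial.
  by_cases ha : a ∈ G.common a b x y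
  · intro ω
    have e1 : {a} ∪ {b} ∪ ({x, y} ∪ G.common a b x y) = {b} ∪ ({x, y} ∪ G.common a b x y) := by
      ext v; simp only [Set.mem_union, Set.mem_singleton_iff]
      constructor
      · rintro ((rfl | h) | h) <;> tauto
      · tauto
    have e2 : {a} ∪ ({x, y} ∪ G.common a b x y) = {x, y} ∪ G.common a b x y := by
      ext v; simp only [Set.mem_union, Set.mem_singleton_iff]
      constructor
      · rintro (rfl | h) <;> tauto
      · tauto
    rw [e1, e2, mul_comm]
  set Z := {x, y} ∪ G.common a b x y
  -- The component of `a` without the common nodes is closed by `left_closed`; it omits `b`, which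
  -- would otherwise be common.
  set S := {v | G.MoralConn (G.Anc {a, y, x}) {x} a v} \ G.common a b x y
  have hd : Disjoint S Z := by
    refine Set.disjoint_left.2 ?_
    rintro v ⟨hv, hvW⟩ ((rfl | rfl) | hv')
    · exact hv.notMem (Z := {v}) h.hax rfl
    · exact h.not_left hv
    · exact hvW hv'
  by_cases hb : b ∈ G.common a b x y
  · intro ω
    have e1 : {a} ∪ {b} ∪ Z = {a} ∪ Z := by
      ext v; simp only [Set.mem_union, Set.mem_singleton_iff]
      constructor
      · rintro ((h | rfl) | h)
        · exact .inl h
        · exact .inr (.inr hb)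
        · exact .inr h
      · tauto
    have e2 : {b} ∪ Z = Z := by
      ext v; simp only [Set.mem_union, Set.mem_singleton_iff]
      constructor
      · rintro (rfl | h)
        · exact .inr hb
        · exact h
      · tauto
    rw [e1, e2]
  refine CondIndep.mono (hP.condIndep_of_moral_closed (M := G.Anc {a, b, x, y})
    (S := S) (Z := Z) (fun v hv => DAG.parents_subset_anc hv) ?_ ?_ hd ?_) ?_ ?_ ?_ hd ?_
  · rintro v ⟨hv, -⟩
    exact G.anc_mono (by rintro _ (rfl | rfl | rfl) <;> simp) (h.left_mem hv)
  · rintro v (hv | hv)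
    · exact G.subset_anc _ (by rcases hv with rfl | rfl <;> simp)
    · exact G.anc_mono (by rintro _ (rfl | rfl | rfl) <;> simp) (h.left_mem hv.1)
  · rintro v ⟨hv, hvW⟩ u huM huZ hadj
    exact ⟨h.left_closed hv hvW (fun H => huZ (.inl (.inl H))) hadj huM, fun H => huZ (.inr H)⟩
  · rintro _ rfl
    exact ⟨.refl, ha⟩
  · rintro _ rfl
    refine ⟨G.subset_anc _ (by simp), ?_⟩
    rintro (H | (H | H) | H)
    · exact hb ⟨H.1, .refl⟩
    · exact h.ne_right H
    · exact h.hby H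
    · exact hb H
  · exact Set.disjoint_left.2 fun v hv hv' => hv'.2 (.inl hv)
  · exact Set.disjoint_left.2 fun v hv hv' => hv.2 (.inr hv')

theorem DAG.LocallySeparated.prob_left (h : G.LocallySeparated a b x y) (hP : G.Compatible P)
    (α : T a) (ξ : T x) (η : T y) {W : Set N}
    (hW : G.common a b x y = W) (w : ∀ v : W, T v) :
    P.toOuterMeasure {ω | ω a = α ∧ ω x = ξ ∧ ω y = η ∧ res W ω = w} *
        P.toOuterMeasure {ω | ω x = ξ} =
      P.toOuterMeasure {ω | ω a = α ∧ ω x = ξ ∧ res W ω = w} *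
        P.toOuterMeasure {ω | ω x = ξ ∧ ω y = η} := by
  classical
  subst hW
  -- The values may be inconsistent when `a` is a common node; both sides then vanish.
  by_cases hex : ∃ ω : ∀ v, T v, ω a = α ∧ ω x = ξ ∧ res (G.common a b x y) ω = w
  · obtain ⟨ω₁, rfl, rfl, rfl⟩ := hex
    have hay : a ≠ y := h.symm.ne_right
    have hWy : ∀ v ∈ G.common a b x y, v ≠ y := fun v hv => (h.notMem_of_common hv).2
    have := h.condIndep_left hP (Function.update ω₁ y η)
    rw [marg_eq_toOuterMeasure (E := {ω | ω a = ω₁ a ∧ ω x = ω₁ x ∧ ω y = η ∧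
        res (G.common a b x y) ω = res _ ω₁}),
      marg_eq_toOuterMeasure (E := {ω | ω x = ω₁ x}),
      marg_eq_toOuterMeasure (E := {ω | ω a = ω₁ a ∧ ω x = ω₁ x ∧
        res (G.common a b x y) ω = res _ ω₁}),
      marg_eq_toOuterMeasure (E := {ω | ω x = ω₁ x ∧ ω y = η})] at this
    · exact this
    all_goals
      intro ω
      have hres : (∀ v ∈ G.common a b x y, ω v = Function.update ω₁ y η v) ↔
          res (G.common a b x y) ω = res _ ω₁ := by
        rw [res_eq_iff]
        exact forall₂_congr fun v hv => by rw [Function.update_of_ne (hWy v hv)]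
      simp only [Set.mem_union, or_imp, forall_and, Set.mem_insert_iff, hres, forall_eq,
        Set.mem_singleton_iff, Function.update_self, Function.update_of_ne h.hxy,
        Function.update_of_ne hay, Set.mem_ofPred_eq]
    all_goals tauto
  · have e1 : {ω : ∀ v, T v | ω a = α ∧ ω x = ξ ∧ ω y = η ∧ res (G.common a b x y) ω = w} = ∅ :=
      Set.eq_empty_of_forall_notMem fun ω hω => hex ⟨ω, hω.1, hω.2.1, hω.2.2.2⟩
    have e2 : {ω : ∀ v, T v | ω a = α ∧ ω x = ξ ∧ res (G.common a b x y) ω = w} = ∅ :=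
      Set.eq_empty_of_forall_notMem fun ω hω => hex ⟨ω, hω⟩
    rw [e1, e2]
    simp

theorem DAG.LocallySeparated.prob_right (h : G.LocallySeparated a b x y) (hP : G.Compatible P)
    (β : T b) (ξ : T x) (η : T y) {W : Set N}
    (hW : G.common a b x y = W) (w : ∀ v : W, T v) :
    P.toOuterMeasure {ω | ω b = β ∧ ω x = ξ ∧ ω y = η ∧ res W ω = w} *
        P.toOuterMeasure {ω | ω y = η} =
      P.toOuterMeasure {ω | ω b = β ∧ ω y = η ∧ res W ω = w} *
        P.toOuterMeasure {ω | ω x = ξ ∧ ω y = η} := by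
  convert h.symm.prob_left hP β η ξ (DAG.common_symm.trans hW) w using 3
  all_goals
    ext ω
    simp only [Set.mem_ofPred_eq]
    tauto

theorem DAG.LocallySeparated.prob_common (h : G.LocallySeparated a b x y) (hP : G.Compatible P)
    (ξ : T x) (η : T y) {W : Set N}
    (hW : G.common a b x y = W) (w : ∀ v : W, T v) :
    P.toOuterMeasure {ω | ω x = ξ ∧ ω y = η ∧ res W ω = w} =
      P.toOuterMeasure {ω | ω x = ξ ∧ ω y = η} * P.toOuterMeasure {ω | res W ω = w} := by
  classical
  subst hW
  by_cases hex : ∃ ω : ∀ v, T v, res (G.common a b x y) ω = w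
  · obtain ⟨ω₁, rfl⟩ := hex
    have hWxy := fun v hv => h.notMem_of_common (v := v) hv
    have := h.condIndep_common hP (Function.update (Function.update ω₁ y η) x ξ)
    rw [marg_eq_toOuterMeasure (E := {ω | ω x = ξ ∧ ω y = η ∧
        res (G.common a b x y) ω = res _ ω₁}), marg_empty, mul_one,
      marg_eq_toOuterMeasure (E := {ω | res (G.common a b x y) ω = res _ ω₁}),
      marg_eq_toOuterMeasure (E := {ω | ω x = ξ ∧ ω y = η}), mul_comm] at this
    · exact this
    all_goals
      intro ω
      have hres : (∀ v ∈ G.common a b x y, ω v =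
          Function.update (Function.update ω₁ y η) x ξ v) ↔
          res (G.common a b x y) ω = res _ ω₁ := by
        rw [res_eq_iff]
        exact forall₂_congr fun v hv => by
          rw [Function.update_of_ne (hWxy v hv).1, Function.update_of_ne (hWxy v hv).2]
      simp only [Set.union_empty, Set.mem_union, or_imp, forall_and, Set.mem_insert_iff, hres,
        forall_eq, Set.mem_singleton_iff, Function.update_self, Function.update_of_ne h.hxy.symm,
        Set.mem_ofPred_eq]
    all_goals tauto
  · have e1 : {ω : ∀ v, T v | ω x = ξ ∧ ω y = η ∧ res (G.common a b x y) ω = w} = ∅ :=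
      Set.eq_empty_of_forall_notMem fun ω hω => hex ⟨ω, hω.2.2⟩
    have e2 : {ω : ∀ v, T v | res (G.common a b x y) ω = w} = ∅ :=
      Set.eq_empty_of_forall_notMem fun ω hω => hex ⟨ω, hω⟩
    rw [e1, e2]
    simp

theorem DAG.LocallySeparated.prob_outcomes (h : G.LocallySeparated a b x y) (hab : a ≠ b)
    (hP : G.Compatible P) (α : T a) (β : T b) (ξ : T x) (η : T y) {W : Set N}
    (hW : G.common a b x y = W) (w : ∀ v : W, T v) :
    P.toOuterMeasure {ω | ω a = α ∧ ω b = β ∧ ω x = ξ ∧ ω y = η ∧ res W ω = w} *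
        P.toOuterMeasure {ω | ω x = ξ ∧ ω y = η ∧ res W ω = w} =
      P.toOuterMeasure {ω | ω a = α ∧ ω x = ξ ∧ ω y = η ∧ res W ω = w} *
        P.toOuterMeasure {ω | ω b = β ∧ ω x = ξ ∧ ω y = η ∧ res W ω = w} := by
  classical
  subst hW
  by_cases hex : (∃ ω : ∀ v, T v, ω a = α ∧ ω x = ξ ∧ ω y = η ∧ res (G.common a b x y) ω = w) ∧
      ∃ ω : ∀ v, T v, ω b = β ∧ ω x = ξ ∧ ω y = η ∧ res (G.common a b x y) ω = w
  · obtain ⟨⟨ω₁, rfl, rfl, rfl, rfl⟩, ω₂, rfl, -, -, h₂⟩ := hex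
    -- Even if `b` is a common node, the update leaves the common values unchanged, as `ω₁` and `ω₂`
    -- agree on them.
    have hW : ∀ v ∈ G.common a b x y, Function.update ω₁ b (ω₂ b) v = ω₁ v := fun v hv => by
      by_cases hvb : v = b
      · subst hvb
        rw [Function.update_self]
        exact res_eq_iff.1 h₂ v hv
      · rw [Function.update_of_ne hvb]
    have := h.condIndep_outcomes hP (Function.update ω₁ b (ω₂ b))
    rw [marg_eq_toOuterMeasure (E := {ω | ω a = ω₁ a ∧ ω b = ω₂ b ∧ ω x = ω₁ x ∧ ω y = ω₁ y ∧
        res (G.common a b x y) ω = res _ ω₁}),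
      marg_eq_toOuterMeasure (E := {ω | ω x = ω₁ x ∧ ω y = ω₁ y ∧
        res (G.common a b x y) ω = res _ ω₁}),
      marg_eq_toOuterMeasure (E := {ω | ω a = ω₁ a ∧ ω x = ω₁ x ∧ ω y = ω₁ y ∧
        res (G.common a b x y) ω = res _ ω₁}),
      marg_eq_toOuterMeasure (E := {ω | ω b = ω₂ b ∧ ω x = ω₁ x ∧ ω y = ω₁ y ∧
        res (G.common a b x y) ω = res _ ω₁})] at this
    · exact this
    all_goals
      intro ω
      have hres : (∀ v ∈ G.common a b x y, ω v = Function.update ω₁ b (ω₂ b) v) ↔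
          res (G.common a b x y) ω = res _ ω₁ := by
        rw [res_eq_iff]
        exact forall₂_congr fun v hv => by rw [hW v hv]
      simp only [Set.mem_union, or_imp, forall_and, Set.mem_insert_iff, hres, forall_eq,
        Set.mem_singleton_iff, Function.update_self, Function.update_of_ne h.ne_right.symm,
        Function.update_of_ne h.hby.symm, Function.update_of_ne hab, Set.mem_ofPred_eq]
    all_goals tauto
  · have e1 : {ω : ∀ v, T v | ω a = α ∧ ω b = β ∧ ω x = ξ ∧ ω y = η ∧
        res (G.common a b x y) ω = w} = ∅ :=
      Set.eq_empty_of_forall_notMem fun ω hω => hex ⟨⟨ω, hω.1, hω.2.2⟩, ⟨ω, hω.2⟩⟩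
    rw [e1]
    rcases not_and_or.1 hex with hex | hex
    · have e2 : {ω : ∀ v, T v | ω a = α ∧ ω x = ξ ∧ ω y = η ∧
          res (G.common a b x y) ω = w} = ∅ :=
        Set.eq_empty_of_forall_notMem fun ω hω => hex ⟨ω, hω⟩
      rw [e2]
      simp
    · have e2 : {ω : ∀ v, T v | ω b = β ∧ ω x = ξ ∧ ω y = η ∧
          res (G.common a b x y) ω = w} = ∅ :=
        Set.eq_empty_of_forall_notMem fun ω hω => hex ⟨ω, hω⟩
      rw [e2]
      simp

/-- Under local separation, the distribution of `a` and `b` given `x` and `y` has a local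
hidden-variable decomposition, in which the hidden variable consists of the common nodes. -/
theorem DAG.LocallySeparated.exists_decomposition (h : G.LocallySeparated a b x y) (hab : a ≠ b)
    (hP : G.Compatible P) :
    ∃ (q : PMF (∀ v : G.common a b x y, T v))
      (KA : T x → (∀ v : G.common a b x y, T v) → PMF (T a))
      (KB : T y → (∀ v : G.common a b x y, T v) → PMF (T b)), ∀ α β ξ η,
      P.toOuterMeasure {ω | ω a = α ∧ ω b = β ∧ ω x = ξ ∧ ω y = η} =
        P.toOuterMeasure {ω | ω x = ξ ∧ ω y = η} * ∑' w, q w * KA ξ w α * KB η w β := by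
  set W := G.common a b x y with hW
  choose KA hKA using fun (ξ : T x) (w : ∀ v : W, T v) =>
    exists_condLaw P (fun ω => ω a) {ω | ω x = ξ ∧ res W ω = w}
  choose KB hKB using fun (η : T y) (w : ∀ v : W, T v) =>
    exists_condLaw P (fun ω => ω b) {ω | ω y = η ∧ res W ω = w}
  refine ⟨P.map (res W), KA, KB, fun α β ξ η => ?_⟩
  rw [toOuterMeasure_eq_tsum_fiber P (res W), ← ENNReal.tsum_mul_left]
  refine tsum_congr fun w => ?_
  have hq : P.map (res W) w = P.toOuterMeasure {ω | res W ω = w} := by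
    rw [← PMF.toOuterMeasure_apply_singleton, PMF.toOuterMeasure_map_apply]
    rfl
  rw [hq]
  have fin := fun E => toOuterMeasure_ne_top P E
  have hA := h.prob_left hP α ξ η hW.symm w
  have hB := h.prob_right hP β ξ η hW.symm w
  have hc := h.prob_common hP ξ η hW.symm w
  have ho := h.prob_outcomes hab hP α β ξ η hW.symm w
  -- Independence of the common nodes from `x` alone follows by summing `prob_common` over the
  -- values of `y`.
  have hx : P.toOuterMeasure {ω | ω x = ξ ∧ res W ω = w} =
      P.toOuterMeasure {ω | ω x = ξ} * P.toOuterMeasure {ω | res W ω = w} := by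
    rw [toOuterMeasure_eq_tsum_fiber P (fun ω => ω y) {ω | ω x = ξ},
      toOuterMeasure_eq_tsum_fiber P (fun ω => ω y) {ω | ω x = ξ ∧ res W ω = w},
      ← ENNReal.tsum_mul_right]
    refine tsum_congr fun η => ?_
    refine Eq.trans (congrArg _ ?_) (h.prob_common hP ξ η hW.symm w)
    ext ω; simp only [Set.mem_ofPred_eq]; tauto
  have hy : P.toOuterMeasure {ω | ω y = η ∧ res W ω = w} =
      P.toOuterMeasure {ω | ω y = η} * P.toOuterMeasure {ω | res W ω = w} := by
    rw [toOuterMeasure_eq_tsum_fiber P (fun ω => ω x) {ω | ω y = η},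
      toOuterMeasure_eq_tsum_fiber P (fun ω => ω x) {ω | ω y = η ∧ res W ω = w},
      ← ENNReal.tsum_mul_right]
    refine tsum_congr fun ξ => ?_
    refine Eq.trans (congrArg _ ?_) ((h.prob_common hP ξ η hW.symm w).trans ?_)
    · ext ω; simp only [Set.mem_ofPred_eq]; tauto
    · congr 2
      ext ω; simp only [Set.mem_ofPred_eq]; tauto
  have hKA' : P.toOuterMeasure {ω | ω x = ξ} * P.toOuterMeasure {ω | res W ω = w} * KA ξ w α =
      P.toOuterMeasure {ω | ω a = α ∧ ω x = ξ ∧ res W ω = w} := by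
    rw [← hx, hKA ξ w α]
    congr 1
    ext ω; simp only [Set.mem_ofPred_eq]; tauto
  have hKB' : P.toOuterMeasure {ω | ω y = η} * P.toOuterMeasure {ω | res W ω = w} * KB η w β =
      P.toOuterMeasure {ω | ω b = β ∧ ω y = η ∧ res W ω = w} := by
    rw [← hy, hKB η w β]
    congr 1
    ext ω; simp only [Set.mem_ofPred_eq]; tauto
  have e0 : {ω : ∀ v, T v | ω ∈ {ω : ∀ v, T v | ω a = α ∧ ω b = β ∧ ω x = ξ ∧ ω y = η} ∧
      res W ω = w} = {ω | ω a = α ∧ ω b = β ∧ ω x = ξ ∧ ω y = η ∧ res W ω = w} := by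
    ext ω; simp only [Set.mem_ofPred_eq]; tauto
  rw [e0]
  have le : ∀ {E F : Set (∀ v, T v)}, E ⊆ F → P.toOuterMeasure F = 0 → P.toOuterMeasure E = 0 :=
    fun hEF => MeasureTheory.measure_mono_null (μ := P.toOuterMeasure) hEF
  have hpq : {ω : ∀ v, T v | ω a = α ∧ ω b = β ∧ ω x = ξ ∧ ω y = η ∧ res W ω = w} ⊆
      {ω | res W ω = w} := fun ω hω => hω.2.2.2.2
  have hpxy : {ω : ∀ v, T v | ω a = α ∧ ω b = β ∧ ω x = ξ ∧ ω y = η ∧ res W ω = w} ⊆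
      {ω | ω x = ξ ∧ ω y = η} := fun ω hω => ⟨hω.2.2.1, hω.2.2.2.1⟩
  by_cases hq0 : P.toOuterMeasure {ω | res W ω = w} = 0
  · rw [le hpq hq0, hq0]
    simp
  by_cases hxy0 : P.toOuterMeasure {ω | ω x = ξ ∧ ω y = η} = 0
  · rw [le hpxy hxy0, hxy0]
    simp
  have hx0 : P.toOuterMeasure {ω | ω x = ξ} ≠ 0 := fun H => hxy0 (le (fun ω hω => hω.1) H)
  have hy0 : P.toOuterMeasure {ω | ω y = η} ≠ 0 := fun H => hxy0 (le (fun ω hω => hω.2) H)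
  rw [hc] at ho
  rw [← hKA'] at hA
  rw [← hKB'] at hB
  generalize P.toOuterMeasure {ω | ω a = α ∧ ω b = β ∧ ω x = ξ ∧ ω y = η ∧ res W ω = w} = p at *
  have fx := fin {ω | ω x = ξ}
  have fy := fin {ω | ω y = η}
  have fxy := fin {ω | ω x = ξ ∧ ω y = η}
  have fq := fin {ω | res W ω = w}
  generalize P.toOuterMeasure {ω | ω x = ξ} = px at *
  generalize P.toOuterMeasure {ω | ω y = η} = py at *
  generalize P.toOuterMeasure {ω | ω x = ξ ∧ ω y = η} = pxy at *
  generalize P.toOuterMeasure {ω | res W ω = w} = pw at *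
  generalize P.toOuterMeasure {ω | ω a = α ∧ ω x = ξ ∧ ω y = η ∧ res W ω = w} = pA at *
  generalize P.toOuterMeasure {ω | ω b = β ∧ ω x = ξ ∧ ω y = η ∧ res W ω = w} = pB at *
  -- Multiplying by this finite nonzero factor makes the three product identities applicable without
  -- division.
  have hne : pxy * pw * px * py ≠ 0 := by simp [*]
  have hnt : pxy * pw * px * py ≠ ⊤ := by finiteness
  rw [← ENNReal.mul_left_inj hne hnt]
  calc p * (pxy * pw * px * py) = (p * (pxy * pw)) * px * py := by ring
    _ = (pA * px) * (pB * py) := by rw [ho]; ring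
    _ = _ := by rw [hA, hB]; ring

end

/-! ### The causal model of a local decomposition -/

section LocalModel

variable {S : BellScenario.{u}} {Λ : Type u}

/-- The causal graph with arrows from the hidden variable and the local setting to each outcome, and
an arrow between the settings. -/
def localGraph : DAG (Obs ⊕ Unit) where
  -- The arrow from `X` to `Y` accommodates an arbitrary joint distribution of the settings.
  edge u v := match u, v with
    | .inr _, .inl .A | .inr _, .inl .B | .inl .X, .inl .A | .inl .Y, .inl .B
    | .inl .X, .inl .Y => True
    | _, _ => False
  acyclic := by
    -- A rank that increases strictly along arrows excludes cycles.
    let r : Obs ⊕ Unit → ℕ := fun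
      | .inl .A | .inl .B => 2
      | .inl .Y => 1
      | _ => 0
    intro v h
    refine lt_irrefl (r v) ?_
    refine Relation.TransGen.trans_induction_on (motive := fun {u v} _ => r u < r v) h ?_ ?_
    · rintro ((_ | _ | _ | _) | _) ((_ | _ | _ | _) | _) h <;> simp_all [r]
    · exact fun _ _ => lt_trans

theorem localGraph_parents :
    localGraph.parents (.inl .A) = {.inl .X, .inr ()} ∧
    localGraph.parents (.inl .B) = {.inl .Y, .inr ()} ∧
    localGraph.parents (.inl .X) = ∅ ∧
    localGraph.parents (.inl .Y) = {.inl .X} ∧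
    localGraph.parents (.inr ()) = ∅ := by
  refine ⟨?_, ?_, ?_, ?_, ?_⟩ <;> ext ((_ | _ | _ | _) | _) <;>
    simp [DAG.parents, localGraph]

/-- The assignment of given values to the observable variables and the hidden variable. -/
def localAssign (o : ∀ o, S.Val o) (l : Λ) (a : S.Val .A) (b : S.Val .B) :
    ∀ v, NodeVal S (fun _ : Unit => Λ) v
  | .inl .A => a
  | .inl .B => b
  | .inl .X => o .X
  | .inl .Y => o .Y
  | .inr _ => l

theorem localAssign_eq_iff {o : ∀ o, S.Val o} {l : Λ} {a : S.Val .A} {b : S.Val .B}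
    {ω : ∀ v, NodeVal S (fun _ : Unit => Λ) v} :
    ω = localAssign o l a b ↔ (o .X = ω (.inl .X) ∧ o .Y = ω (.inl .Y)) ∧ l = ω (.inr ()) ∧
      a = ω (.inl .A) ∧ b = ω (.inl .B) := by
  constructor
  · rintro rfl
    exact ⟨⟨rfl, rfl⟩, rfl, rfl, rfl⟩
  · rintro ⟨⟨h1, h2⟩, h3, h4, h5⟩
    funext v
    rcases v with (_ | _ | _ | _) | _
    · exact h4.symm
    · exact h5.symm
    · exact h1.symm
    · exact h2.symm
    · exact h3.symm

/-- The joint distribution of a local hidden-variable model. -/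
noncomputable def localJoint (P : S.Phenomenon) (q : PMF Λ) (KA : S.Val .X → Λ → PMF (S.Val .A))
    (KB : S.Val .Y → Λ → PMF (S.Val .B)) : PMF (∀ v, NodeVal S (fun _ : Unit => Λ) v) :=
  -- Only the settings of `o` are kept; the outcomes are drawn afresh from `KA` and `KB`.
  P.bind fun o => q.bind fun l => (KA (o .X) l).bind fun a => (KB (o .Y) l).bind fun b =>
    PMF.pure (localAssign o l a b)

variable (P : S.Phenomenon) (q : PMF Λ) (KA : S.Val .X → Λ → PMF (S.Val .A))
  (KB : S.Val .Y → Λ → PMF (S.Val .B))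

theorem localJoint_apply (ω : ∀ v, NodeVal S (fun _ : Unit => Λ) v) :
    localJoint P q KA KB ω = marg P {Obs.X, Obs.Y} (obsPart ω) * q (ω (.inr ())) *
      KA (ω (.inl .X)) (ω (.inr ())) (ω (.inl .A)) *
      KB (ω (.inl .Y)) (ω (.inr ())) (ω (.inl .B)) := by
  classical
  simp only [localJoint, PMF.bind_apply, PMF.pure_apply]
  rw [marg, PMF.toOuterMeasure_apply]
  simp only [← ENNReal.tsum_mul_right]
  refine tsum_congr fun o => ?_
  by_cases ho : o .X = ω (.inl .X) ∧ o .Y = ω (.inl .Y)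
  · rw [Set.indicator_of_mem (by simpa [obsPart] using ho),
      tsum_eq_single (ω (.inr ())), tsum_eq_single (ω (.inl .A)), tsum_eq_single (ω (.inl .B)),
      if_pos (localAssign_eq_iff.2 ⟨ho, rfl, rfl, rfl⟩), ho.1, ho.2]
    · ring
    · intro b hb
      simp [localAssign_eq_iff, hb]
    · intro a ha
      simp [localAssign_eq_iff, ha]
    · intro l hl
      simp [localAssign_eq_iff, hl]
  · rw [Set.indicator_of_notMem (by simpa [obsPart] using ho)]
    simp [localAssign_eq_iff, ho]

theorem sumOut_localJoint_formula {M : Set (Obs ⊕ Unit)} {M' : Set (Obs ⊕ Unit)} {v : Obs ⊕ Unit}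
    (hv : v ∉ M) (hM : insert v M = M') {f g : (∀ v, NodeVal S (fun _ : Unit => Λ) v) → ENNReal}
    (hf : marg (localJoint P q KA KB) M' = f) (hg : sumOut v f = g) : marg (localJoint P q KA KB) M = g := by
  rw [← sumOut_marg _ hv, hM, hf, hg]

theorem sumOut_marg_obs {o : Obs} {M : Set Obs} (ho : o ∉ M)
    (ω : ∀ v, NodeVal S (fun _ : Unit => Λ) v) (hdec : DecidableEq (Obs ⊕ Unit)) :
    ∑' t : S.Val o, marg P (insert o M) (obsPart (Function.update ω (.inl o) t)) =
      marg P M (obsPart ω) := by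
  classical
  rw [← sumOut_marg P ho]
  refine tsum_congr fun t => ?_
  congr 1
  funext o'
  by_cases h : o' = o
  · subst h; simp [obsPart]
  · simp [obsPart, h]

theorem obsPart_update_inr (ω : ∀ v, NodeVal S (fun _ : Unit => Λ) v) (t : Λ)
    [DecidableEq (Obs ⊕ Unit)] :
    obsPart (Function.update ω (.inr ()) t) = obsPart ω := by
  funext o
  simp [obsPart]

theorem marg_obsPart_update {M : Set Obs} {o : Obs} (ho : o ∉ M)
    (ω : ∀ v, NodeVal S (fun _ : Unit => Λ) v) (t : S.Val o) [DecidableEq (Obs ⊕ Unit)] :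
    marg P M (obsPart (Function.update ω (.inl o) t)) = marg P M (obsPart ω) :=
  marg_congr P fun o' h => by
    have : o' ≠ o := fun H => ho (H ▸ h)
    simp [obsPart, this]

theorem marg_AXYL : marg (localJoint P q KA KB) {.inl .A, .inl .X, .inl .Y, .inr ()} = fun ω =>
    marg P {Obs.X, Obs.Y} (obsPart ω) * q (ω (.inr ())) *
      KA (ω (.inl .X)) (ω (.inr ())) (ω (.inl .A)) := by
  refine sumOut_localJoint_formula P q KA KB (v := .inl .B) (M' := Set.univ) (by simp) ?_
    (funext fun ω => (marg_univ _ ω).trans (localJoint_apply P q KA KB ω)) ?_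
  · ext ((_ | _ | _ | _) | _) <;> simp
  · funext ω
    simp only [sumOut, Function.update_self, ne_eq, reduceCtorEq, not_false_eq_true,
      Function.update_of_ne, Sum.inl.injEq]
    simp only [marg_obsPart_update P (M := {Obs.X, Obs.Y}) (o := Obs.B) (by simp),
      ENNReal.tsum_mul_left, PMF.tsum_coe, mul_one]

theorem marg_BXYL : marg (localJoint P q KA KB) {.inl .B, .inl .X, .inl .Y, .inr ()} = fun ω =>
    marg P {Obs.X, Obs.Y} (obsPart ω) * q (ω (.inr ())) *
      KB (ω (.inl .Y)) (ω (.inr ())) (ω (.inl .B)) := by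
  refine sumOut_localJoint_formula P q KA KB (v := .inl .A) (M' := Set.univ) (by simp) ?_
    (funext fun ω => (marg_univ _ ω).trans (localJoint_apply P q KA KB ω)) ?_
  · ext ((_ | _ | _ | _) | _) <;> simp
  · funext ω
    simp only [sumOut, Function.update_self, ne_eq, reduceCtorEq, not_false_eq_true,
      Function.update_of_ne, Sum.inl.injEq]
    simp only [marg_obsPart_update P (M := {Obs.X, Obs.Y}) (o := Obs.A) (by simp),
      ENNReal.tsum_mul_left, ENNReal.tsum_mul_right, PMF.tsum_coe, mul_one]

theorem marg_AXL : marg (localJoint P q KA KB) {.inl .A, .inl .X, .inr ()} = fun ω =>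
    marg P {Obs.X} (obsPart ω) * q (ω (.inr ())) *
      KA (ω (.inl .X)) (ω (.inr ())) (ω (.inl .A)) := by
  refine sumOut_localJoint_formula P q KA KB (v := .inl .Y) (by simp) ?_
    (marg_AXYL P q KA KB) ?_
  · ext ((_ | _ | _ | _) | _) <;> simp
  · funext ω
    simp only [sumOut, ne_eq, reduceCtorEq, not_false_eq_true,
      Function.update_of_ne, Sum.inl.injEq, ENNReal.tsum_mul_right]
    rw [← sumOut_marg_obs P (o := Obs.Y) (M := {Obs.X}) (by simp), Set.pair_comm]

theorem marg_BYL : marg (localJoint P q KA KB) {.inl .B, .inl .Y, .inr ()} = fun ω =>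
    marg P {Obs.Y} (obsPart ω) * q (ω (.inr ())) *
      KB (ω (.inl .Y)) (ω (.inr ())) (ω (.inl .B)) := by
  refine sumOut_localJoint_formula P q KA KB (v := .inl .X) (by simp) ?_
    (marg_BXYL P q KA KB) ?_
  · ext ((_ | _ | _ | _) | _) <;> simp
  · funext ω
    simp only [sumOut, ne_eq, reduceCtorEq, not_false_eq_true,
      Function.update_of_ne, Sum.inl.injEq, ENNReal.tsum_mul_right]
    rw [← sumOut_marg_obs P (o := Obs.X) (M := {Obs.Y}) (by simp)]

theorem marg_XL : marg (localJoint P q KA KB) {.inl .X, .inr ()} = fun ω =>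
    marg P {Obs.X} (obsPart ω) * q (ω (.inr ())) := by
  refine sumOut_localJoint_formula P q KA KB (v := .inl .A) (by simp) rfl
    (marg_AXL P q KA KB) ?_
  funext ω
  simp only [sumOut, Function.update_self, ne_eq, reduceCtorEq, not_false_eq_true,
    Function.update_of_ne, Sum.inl.injEq]
  simp only [marg_obsPart_update P (M := {Obs.X}) (o := Obs.A) (by simp),
    ENNReal.tsum_mul_left, PMF.tsum_coe, mul_one]

theorem marg_YL : marg (localJoint P q KA KB) {.inl .Y, .inr ()} = fun ω =>
    marg P {Obs.Y} (obsPart ω) * q (ω (.inr ())) := by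
  refine sumOut_localJoint_formula P q KA KB (v := .inl .B) (by simp) rfl
    (marg_BYL P q KA KB) ?_
  funext ω
  simp only [sumOut, Function.update_self, ne_eq, reduceCtorEq, not_false_eq_true,
    Function.update_of_ne, Sum.inl.injEq]
  simp only [marg_obsPart_update P (M := {Obs.Y}) (o := Obs.B) (by simp),
    ENNReal.tsum_mul_left, PMF.tsum_coe, mul_one]

theorem marg_L : marg (localJoint P q KA KB) {.inr ()} = fun ω => q (ω (.inr ())) := by
  refine sumOut_localJoint_formula P q KA KB (v := .inl .X) (by simp) rfl
    (marg_XL P q KA KB) ?_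
  funext ω
  simp only [sumOut, ne_eq, reduceCtorEq, not_false_eq_true,
    Function.update_of_ne, ENNReal.tsum_mul_right]
  have := sumOut_marg_obs P (o := Obs.X) (M := ∅) (by simp) ω (Classical.decEq _)
  simp only [insert_empty_eq, marg_empty] at this
  exact (congrArg (· * q (ω (.inr ()))) this).trans (one_mul _)

theorem marg_map_obsPart {L : Type} {T : L → Type u} (μ : PMF (∀ v, NodeVal S T v)) (s : Set Obs)
    (ω : ∀ v, NodeVal S T v) : marg (μ.map obsPart) s (obsPart ω) = marg μ (Sum.inl '' s) ω := by
  rw [marg, PMF.toOuterMeasure_map_apply, marg]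
  congr 1
  ext ω'
  simp [obsPart]

theorem localJoint_map (hdec : ∀ x : ∀ o, S.Val o, P x = marg P {Obs.X, Obs.Y} x *
    ∑' l, q l * KA (x .X) l (x .A) * KB (x .Y) l (x .B)) :
    (localJoint P q KA KB).map obsPart = P := by
  classical
  ext x
  -- Some hidden value is needed to extend `x` to a full assignment.
  obtain ⟨l, -⟩ := q.support_nonempty
  obtain ⟨ω, rfl⟩ : ∃ ω : ∀ v, NodeVal S (fun _ : Unit => Λ) v, obsPart ω = x :=
    ⟨localAssign x l (x .A) (x .B), by funext o; cases o <;> rfl⟩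
  have hM : insert (.inr ()) (Sum.inl '' (Set.univ : Set Obs)) =
      (Set.univ : Set (Obs ⊕ Unit)) := by
    ext ((_ | _ | _ | _) | _) <;> simp
  rw [← marg_univ, marg_map_obsPart, ← sumOut_marg _ (v := .inr ()) (by simp), hM, hdec,
    ← ENNReal.tsum_mul_left]
  refine tsum_congr fun t => ?_
  rw [marg_univ, localJoint_apply, obsPart_update_inr]
  simp [obsPart, mul_assoc]

theorem marg_localJoint_inl (hdec : ∀ x : ∀ o, S.Val o, P x = marg P {Obs.X, Obs.Y} x *
    ∑' l, q l * KA (x .X) l (x .A) * KB (x .Y) l (x .B)) (s : Set Obs)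
    (ω : ∀ v, NodeVal S (fun _ : Unit => Λ) v) :
    marg (localJoint P q KA KB) (Sum.inl '' s) ω = marg P s (obsPart ω) := by
  rw [← marg_map_obsPart, localJoint_map P q KA KB hdec]

theorem condProb_localJoint_left {ω : ∀ v, NodeVal S (fun _ : Unit => Λ) v}
    (hx : marg P {Obs.X} (obsPart ω) ≠ 0) (hq : q (ω (.inr ())) ≠ 0) :
    condProb (localJoint P q KA KB) {.inl .A} {.inl .X, .inr ()} ω =
      KA (ω (.inl .X)) (ω (.inr ())) (ω (.inl .A)) := by
  rw [condProb, Set.singleton_union, marg_AXL, marg_XL]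
  simp only
  rw [mul_comm]
  exact ENNReal.mul_div_cancel_right (mul_ne_zero hx hq)
    (ENNReal.mul_ne_top (marg_ne_top _ _ _) (q.apply_ne_top _))

theorem condProb_localJoint_right {ω : ∀ v, NodeVal S (fun _ : Unit => Λ) v}
    (hy : marg P {Obs.Y} (obsPart ω) ≠ 0) (hq : q (ω (.inr ())) ≠ 0) :
    condProb (localJoint P q KA KB) {.inl .B} {.inl .Y, .inr ()} ω =
      KB (ω (.inl .Y)) (ω (.inr ())) (ω (.inl .B)) := by
  rw [condProb, Set.singleton_union, marg_BYL, marg_YL]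
  simp only
  rw [mul_comm]
  exact ENNReal.mul_div_cancel_right (mul_ne_zero hy hq)
    (ENNReal.mul_ne_top (marg_ne_top _ _ _) (q.apply_ne_top _))

theorem localJoint_compatible (hdec : ∀ x : ∀ o, S.Val o, P x = marg P {Obs.X, Obs.Y} x *
    ∑' l, q l * KA (x .X) l (x .A) * KB (x .Y) l (x .B)) :
    localGraph.Compatible (localJoint P q KA KB) := by
  intro ω
  obtain ⟨hA, hB, hX, hY, hL⟩ := localGraph_parents
  have huniv : (Finset.univ : Finset Obs) = {.A, .B, .X, .Y} := rfl
  have eX : condProb (localJoint P q KA KB) {.inl .X} ∅ ω = marg P {Obs.X} (obsPart ω) := by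
    have := marg_localJoint_inl P q KA KB hdec {Obs.X} ω
    rw [Set.image_singleton] at this
    rw [condProb, Set.union_empty, marg_empty, div_one, this]
  have eY : condProb (localJoint P q KA KB) {.inl .Y} {.inl .X} ω =
      marg P {Obs.X, Obs.Y} (obsPart ω) / marg P {Obs.X} (obsPart ω) := by
    have h1 := marg_localJoint_inl P q KA KB hdec {Obs.X} ω
    have h2 := marg_localJoint_inl P q KA KB hdec {Obs.X, Obs.Y} ω
    rw [Set.image_singleton] at h1
    rw [Set.image_pair] at h2
    rw [condProb, Set.singleton_union, Set.pair_comm, h1, h2]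
  have eL : condProb (localJoint P q KA KB) {.inr ()} ∅ ω = q (ω (.inr ())) := by
    rw [condProb, Set.union_empty, marg_empty, div_one, marg_L]
  rw [localJoint_apply, Fintype.prod_sum_type, huniv]
  simp only [Finset.mem_insert, reduceCtorEq, Finset.mem_singleton, or_self, not_false_eq_true,
    Finset.prod_insert, Finset.prod_singleton, Finset.univ_unique, PUnit.default_eq_unit, hA, hB,
    hX, hY, hL, eX, eY, eL]
  -- Where the hidden value or the settings have probability zero, both sides vanish; elsewhere the
  -- conditionals of the outcomes are the kernels themselves.
  by_cases hq : q (ω (.inr ())) = 0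
  · simp [hq]
  by_cases hxy : marg P {Obs.X, Obs.Y} (obsPart ω) = 0
  · simp [hxy]
  have hx : marg P {Obs.X} (obsPart ω) ≠ 0 := fun H =>
    hxy (le_antisymm (H ▸ marg_anti P (by simp) _) zero_le)
  have hy : marg P {Obs.Y} (obsPart ω) ≠ 0 := fun H =>
    hxy (le_antisymm (H ▸ marg_anti P (by simp) _) zero_le)
  rw [condProb_localJoint_left P q KA KB hx hq, condProb_localJoint_right P q KA KB hy hq,
    ENNReal.mul_div_cancel hx (marg_ne_top _ _ _)]
  ring

/-- A phenomenon whose conditional distribution of the outcomes given the settings has a local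
decomposition is Bell-local, whatever the distribution of the settings. -/
theorem bellLocal_of_decomposition (hdec : ∀ x : ∀ o, S.Val o, P x = marg P {Obs.X, Obs.Y} x *
    ∑' l, q l * KA (x .X) l (x .A) * KB (x .Y) l (x .B)) : BellLocal P := by
  let Γ : CausalModel P :=
    { Latent := Unit
      latentVal := fun _ => Λ
      graph := localGraph
      joint := localJoint P q KA KB
      compatible := localJoint_compatible P q KA KB hdec
      marginal := localJoint_map P q KA KB hdec }
  refine ⟨Γ, fun x hxy => ?_⟩
  have hlat : Γ.latents = {.inr ()} := by
    ext ((_ | _ | _ | _) | _) <;> simp [CausalModel.latents, Γ]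
  have hx : marg P {Obs.X} x ≠ 0 := fun H =>
    hxy (le_antisymm (H ▸ marg_anti P (by simp) _) zero_le)
  have hy : marg P {Obs.Y} x ≠ 0 := fun H =>
    hxy (le_antisymm (H ▸ marg_anti P (by simp) _) zero_le)
  have huniv : ({Obs.A, Obs.B} ∪ {Obs.X, Obs.Y} : Set Obs) = Set.univ := by
    ext (_ | _ | _ | _) <;> simp
  rw [condProb, huniv, marg_univ, hdec, mul_comm,
    ENNReal.mul_div_cancel_right hxy (marg_ne_top _ _ _), hlat]
  refine ((Equiv.funUnique Unit Λ).tsum_eq _).symm.trans (tsum_congr fun l => ?_)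
  have hL : marg Γ.joint {.inr ()} (Γ.assign x l) = q (l ()) :=
    congrFun (marg_L P q KA KB) (Γ.assign x l)
  have e1 : obsPart (Γ.assign x l) = x := rfl
  rw [hL, Set.singleton_union, Set.singleton_union]
  change q (l ()) * _ * _ = _
  by_cases hq : q (l ()) = 0
  · simp [hq]
  have h1 : condProb Γ.joint {.inl .A} {.inl .X, .inr ()} (Γ.assign x l) =
      KA (x .X) (l ()) (x .A) :=
    condProb_localJoint_left P q KA KB (ω := Γ.assign x l) hx hq
  have h2 : condProb Γ.joint {.inl .B} {.inl .Y, .inr ()} (Γ.assign x l) =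
      KB (x .Y) (l ()) (x .B) :=
    condProb_localJoint_right P q KA KB (ω := Γ.assign x l) hy hq
  rw [h1, h2]
  rfl

end LocalModel

/-! ### From no-signalling and faithfulness to Bell locality -/

variable {S : BellScenario.{u}} {P : S.Phenomenon}

theorem condIndep_of_condProb_eq {N : Type*} {T : N → Type*} {P : PMF (∀ v, T v)} {C D E : Set N}
    (h : ∀ x, marg P (D ∪ E) x ≠ 0 → condProb P C (D ∪ E) x = condProb P C E x) :
    CondIndep P C D E := by
  intro x
  rw [Set.union_assoc]
  by_cases h0 : marg P (D ∪ E) x = 0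
  · have h1 : marg P (C ∪ (D ∪ E)) x = 0 :=
      le_antisymm (h0 ▸ marg_anti P Set.subset_union_right x) zero_le
    rw [h0, h1, mul_zero, zero_mul]
  have hE : marg P E x ≠ 0 := fun H =>
    h0 (le_antisymm (H ▸ marg_anti P Set.subset_union_right x) zero_le)
  have := h x h0
  rw [condProb, condProb, ENNReal.div_eq_div_iff hE (marg_ne_top _ _ _) h0 (marg_ne_top _ _ _)] at this
  rw [mul_comm, this, mul_comm]

theorem NoSignalling.condIndep_left (h : NoSignalling P) : CondIndep P {.A} {.Y} {.X} :=
  condIndep_of_condProb_eq fun x hx => by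
    rw [Set.singleton_union, Set.pair_comm] at hx ⊢
    exact (h x hx).1

theorem NoSignalling.condIndep_right (h : NoSignalling P) : CondIndep P {.B} {.X} {.Y} :=
  condIndep_of_condProb_eq fun x hx => by
    rw [Set.singleton_union] at hx ⊢
    exact (h x hx).2

theorem CausalModel.Faithful.locallySeparated {Γ : CausalModel P} (hΓ : Γ.Faithful)
    (hNS : NoSignalling P) :
    Γ.graph.LocallySeparated (.inl .A) (.inl .B) (.inl .X) (.inl .Y) := by
  -- The symmetric form is the one in which `not_moralConn` yields a connection starting at the
  -- outcome.
  have hA : CondIndep P {Obs.Y} {Obs.A} {Obs.X} := CondIndep.symm hNS.condIndep_left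
  have hB : CondIndep P {Obs.X} {Obs.B} {Obs.Y} := CondIndep.symm hNS.condIndep_right
  have h1 := hΓ {Obs.Y} {Obs.A} {Obs.X} (by simp) (by simp) (by simp) hA
  have h2 := hΓ {Obs.X} {Obs.B} {Obs.Y} (by simp) (by simp) (by simp) hB
  simp only [Set.image_singleton] at h1 h2
  exact ⟨by simp, by simp, by simp, h1.not_moralConn (by simp), h2.not_moralConn (by simp)⟩

theorem CausalModel.toOuterMeasure_joint (Γ : CausalModel P) (E : Set (∀ o, S.Val o)) :
    Γ.joint.toOuterMeasure {ω | obsPart ω ∈ E} = P.toOuterMeasure E := by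
  conv_rhs => rw [← Γ.marginal]
  rw [PMF.toOuterMeasure_map_apply]
  rfl

end BellCausal

/-- In a bipartite Bell scenario, a no-signalling phenomenon that has a causal model without
fine-tuning is Bell-local. -/
theorem corollary1 (S : BellCausal.BellScenario.{u}) (P : S.Phenomenon)
    (hNS : BellCausal.NoSignalling P) (Γ : BellCausal.CausalModel P) (hΓ : Γ.Faithful) :
    BellCausal.BellLocal P := by
  obtain ⟨q, KA, KB, h⟩ :=
    (hΓ.locallySeparated hNS).exists_decomposition (by simp) Γ.compatible
  refine BellCausal.bellLocal_of_decomposition P q KA KB fun x => ?_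
  -- The four observables determine the assignment, so the left side of the decomposition is a point
  -- probability.
  have huniv : {o : ∀ o, S.Val o | o .A = x .A ∧ o .B = x .B ∧ o .X = x .X ∧ o .Y = x .Y} =
      {x} := by
    ext o
    refine ⟨fun ⟨hA, hB, hX, hY⟩ => ?_, fun ho => ?_⟩
    · funext v
      cases v <;> assumption
    · obtain rfl : o = x := ho
      exact ⟨rfl, rfl, rfl, rfl⟩
  have hobs : {o : ∀ o, S.Val o | o .X = x .X ∧ o .Y = x .Y} =
      {o | ∀ v ∈ ({.X, .Y} : Set BellCausal.Obs), o v = x v} := by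
    ext o
    simp
  have hl := Γ.toOuterMeasure_joint
    {o | o .A = x .A ∧ o .B = x .B ∧ o .X = x .X ∧ o .Y = x .Y}
  have hr := Γ.toOuterMeasure_joint {o | o .X = x .X ∧ o .Y = x .Y}
  have hP := (congrArg P.toOuterMeasure huniv).trans (P.toOuterMeasure_apply_singleton x)
  exact (hl.trans hP).symm.trans ((h (x .A) (x .B) (x .X) (x .Y)).trans (congrArg (· * _)
    (hr.trans (congrArg P.toOuterMeasure hobs))))
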